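/- Let $D_1,\dots,D_n$ be closed disks of positive radius in the plane, $D_i$ having center $p_i$ and radius $r_i$, and write $d_i(q)=|p_iq|-r_i$ for the (signed) distance of a point $q$ to $D_i$. Two disks $D_a,D_b$ are disjoint if $|p_ap_b|>r_a+r_b$. A set of disks is independent if its members are pairwise disjoint, and strongly convex if the bounding circle of each member contributes exactly one (nondegenerate) arc to the boundary of the convex hull of the set. Assume that $\{D_1,\dots,D_n\}$ is strongly convex, that the indices follow the counterclockwise order of the arcs of the disks along the boundary of the convex hull of all disks, and that the disks are in general position: no point is equidistant from four of the disks, and no line is tangent to three of them. For $i\ne j$ let $\mathcal D(i,j)$ be the set of the disks strictly between $D_i$ and $D_j$ in this counterclockwise cyclic order, and let $\mathcal D'(i,j)$ be the set of all $D\in\mathcal D(i,j)$ such that $\{D,D_i,D_j\}$ is a strongly convex independent set. Let $K$ be the set of all indices $k$ such that $D_k\in\mathcal D(j,i)$ and $\{D_i,D_j,D_k\}$ is a strongly convex independent set, together with the special index $0$ if $D_i$ and $D_j$ are disjoint. For $k\in K$, $k\neq 0$, let $v_{ijk}$ be the point equidistant from $D_i,D_j,D_k$, and let $D_{ijk}$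 be the closed disk with center $v_{ijk}$ and radius $d_i(v_{ijk})$, which is tangent to the three disks. Choose coordinates in which $p_j-p_i$ points horizontally to the right. Let $D_{ij0}$ be the closed upper halfplane bounded by the upper outer common tangent line of $D_i$ and $D_j$, and regard $v_{ij0}$ as infinitely high. On the bisector $\gamma_{ij}=\{q: d_i(q)=d_j(q)\}$ write $a\prec b$ if $a$ has smaller $y$-coordinate than $b$; thus also $v_{ijk}\prec v_{ij0}$ for every $k\in K\setminus\{0\}$. Finally, for $k\in K$ let $\mathcal D'_k(i,j)$ be the set of the disks $D\in\mathcal D(i,j)$ that are disjoint from $D_i$ and $D_j$ and, if $k\ne0$, from $D_{ijk}$, and for which $\{D,D_i,D_j\}$ is strongly convex. Then the point $v_{ijk}$ exists and is unique for every $k\in K\setminus\{0\}$. Moreover, for all $k,k'\in K$ with $v_{ijk}\prec v_{ijk'}$: every disk $D_h\in\mathcal D'(i,j)$ that is disjoint from $D_{ijk}$ is also disjoint from $D_{ijk'}$; consequently $\mathcal D'_k(i,j)\subseteq\mathcal D'_{k'}(i,j)$. -/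

import Mathlib

open Set

noncomputable section

/-- The Euclidean plane. -/
abbrev Plane := EuclideanSpace ℝ (Fin 2)

/-- A disk of positive radius in the plane. -/
structure Disk where
  center : Plane
  radius : ℝ
  radius_pos : 0 < radius

namespace Disk

/-- The closed region covered by the disk. -/
def carrier (A : Disk) : Set Plane := Metric.closedBall A.center A.radius

/-- The bounding circle of the disk. -/
def circle (A : Disk) : Set Plane := Metric.sphere A.center A.radius

/-- Two disks are disjoint if the distance of their centers exceeds the sum of their radii. -/
def Disj (A B : Disk) : Prop := A.radius + B.radius < dist A.center B.center

/-- The (signed) distance from a point to a disk: the additively weighted distance to the center,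
with weight minus the radius. -/
def wdist (A : Disk) (q : Plane) : ℝ := dist A.center q - A.radius

end Disk

/-- The unit vector with polar angle `t`. -/
def unitVec (t : ℝ) : Plane := !₂[Real.cos t, Real.sin t]

/-- The cross product of two plane vectors; it is positive if `b` points to the left of `a`. -/
def cross (a b : Plane) : ℝ := a 0 * b 1 - a 1 * b 0

variable {n : ℕ}

/-- The convex hull of the disks with index in `S`. -/
def hull (D : Fin n → Disk) (S : Set (Fin n)) : Set Plane :=
  convexHull ℝ (⋃ i ∈ S, (D i).carrier)

/-- The part of the circle bounding the `i`-th disk that appears on the boundary of the convex hull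
of the disks with index in `S`. -/
def contact (D : Fin n → Disk) (S : Set (Fin n)) (i : Fin n) : Set Plane :=
  (D i).circle ∩ frontier (hull D S)

/-- The disks with index in `S` are in strongly convex position: every one of them has a single arc
on the boundary of the convex hull, that is, its circle meets that boundary in a connected set with
more than one point. -/
def StronglyConvex (D : Fin n → Disk) (S : Set (Fin n)) : Prop :=
  ∀ i ∈ S, (contact D S i).Nontrivial ∧ IsConnected (contact D S i)

/-- The disks with index in `S` are pairwise disjoint. -/
def Independent (D : Fin n → Disk) (S : Set (Fin n)) : Prop :=
  ∀ i ∈ S, ∀ j ∈ S, i ≠ j → (D i).Disj (D j)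

/-- The line `{q | ⟪u, q⟫ = c}`, with `u` a unit vector, is tangent to the disk `A`. -/
def TangentLine (A : Disk) (u : Plane) (c : ℝ) : Prop :=
  |inner ℝ u A.center - c| = A.radius

/-- No point is equidistant from four disks, and no line is tangent to three disks. -/
structure GeneralPosition (D : Fin n → Disk) : Prop where
  no_equidistant : ∀ i j k l : Fin n, i ≠ j → i ≠ k → i ≠ l → j ≠ k → j ≠ l → k ≠ l →
    ¬ ∃ q : Plane, (D i).wdist q = (D j).wdist q ∧ (D i).wdist q = (D k).wdist q ∧
      (D i).wdist q = (D l).wdist q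
  no_tangent : ∀ i j k : Fin n, i ≠ j → i ≠ k → j ≠ k →
    ¬ ∃ (u : Plane) (c : ℝ), ‖u‖ = 1 ∧ TangentLine (D i) u c ∧ TangentLine (D j) u c ∧
      TangentLine (D k) u c

/-- The disks are indexed in the counterclockwise order of their arcs along the boundary of the
convex hull of all disks: seen from any interior point `o` of the hull, any choice of points `q i`,
one on each arc, is met in the order of the indices during one counterclockwise turn. -/
def CounterclockwiseIndexed (D : Fin n → Disk) : Prop :=
  ∀ o ∈ interior (hull D univ), ∀ q : Fin n → Plane, (∀ i, q i ∈ contact D univ i) →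
    ∃ t : Fin n → ℝ, StrictMono t ∧ (∀ i j, t j < t i + 2 * Real.pi) ∧
      ∀ i, ∃ s : ℝ, 0 < s ∧ q i = o + s • unitVec (t i)

/-- The (indices of the) disks strictly between the `i`-th and the `j`-th one in the cyclic order:
`i+1, …, j-1` if `i < j`, and `i+1, …, n, 1, …, j-1` if `j < i`. -/
def between (i j : Fin n) : Set (Fin n) :=
  {h | (i < j ∧ i < h ∧ h < j) ∨ (j < i ∧ (i < h ∨ h < j))}

/-- Canonical triples `(i, j, k)`. The third index is a disk index, `some k`, or the special index
`0`, rendered as `none`. For a disk index, the disks `i`, `j`, `k` have to appear in this cyclic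
order and to form a strongly convex independent set. -/
def Canonical (D : Fin n → Disk) (i j : Fin n) : Option (Fin n) → Prop
  | some k => k ∈ between j i ∧ StronglyConvex D {i, j, k} ∧ Independent D {i, j, k}
  | none => (D i).Disj (D j)

/-- The set of all third indices `k` for which `(i, j, k)` is canonical. -/
def canonicalIndices (D : Fin n → Disk) (i j : Fin n) : Set (Option (Fin n)) :=
  {k | Canonical D i j k}

/-- The point `v` has the same distance to the three disks `i`, `j`, `k`. -/
def Equidistant (D : Fin n → Disk) (i j k : Fin n) (v : Plane) : Prop :=
  (D i).wdist v = (D j).wdist v ∧ (D i).wdist v = (D k).wdist v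

/-- The point equidistant from the three disks `i`, `j`, `k`
(an arbitrary point if there is none). -/
def vertex (D : Fin n → Disk) (i j k : Fin n) : Plane :=
  Classical.epsilon (Equidistant D i j k)

/-- The closed halfplane bounded by the upper outer common tangent line `{q | ⟪u, q⟫ = c}` of the
disks `i` and `j` and lying above it. Here the direction from the center of disk `i` to the center
of disk `j` is regarded as pointing horizontally to the right. -/
def upperHalfplane (D : Fin n → Disk) (i j : Fin n) : Set Plane :=
  {q | ∃ (u : Plane) (c : ℝ), ‖u‖ = 1 ∧ 0 < cross ((D j).center - (D i).center) u ∧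
    inner ℝ u (D i).center + (D i).radius = c ∧ inner ℝ u (D j).center + (D j).radius = c ∧
    c ≤ inner ℝ u q}

/-- The tangent disk of `(i, j, k)`: the disk centered at the vertex of `i`, `j`, `k` whose radius
is the common distance; for the special index it is the upper halfplane. -/
def tangentDisk (D : Fin n → Disk) (i j : Fin n) : Option (Fin n) → Set Plane
  | some k => Metric.closedBall (vertex D i j k) ((D i).wdist (vertex D i j k))
  | none => upperHalfplane D i j

/-- The bisector of the disks `i` and `j`. -/
def bisector (D : Fin n → Disk) (i j : Fin n) : Set Plane :=
  {q | (D i).wdist q = (D j).wdist q}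

/-- The order on the bisector of the disks `i` and `j`: `a` is lower than `b`, in coordinates in
which the direction from the center of disk `i` to the center of disk `j` points horizontally to
the right. -/
def PrecPoint (D : Fin n → Disk) (i j : Fin n) (a b : Plane) : Prop :=
  a ∈ bisector D i j ∧ b ∈ bisector D i j ∧
    cross ((D j).center - (D i).center) a < cross ((D j).center - (D i).center) b

/-- The order of the vertices of `(i, j, k)` and `(i, j, k')` along the bisector, where the vertex
for the special index is infinitely high. -/
def PrecVertex (D : Fin n → Disk) (i j : Fin n) : Option (Fin n) → Option (Fin n) → Prop
  | some k, some k' => PrecPoint D i j (vertex D i j k) (vertex D i j k')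
  | some _, none => True
  | none, _ => False

/-- The disks between `i` and `j` that form a strongly convex independent set with them. -/
def candidates (D : Fin n → Disk) (i j : Fin n) : Set (Fin n) :=
  {h | h ∈ between i j ∧ StronglyConvex D {h, i, j} ∧ Independent D {h, i, j}}

/-- The disks between `i` and `j` that are disjoint from the disks `i` and `j` and from the tangent
disk of `(i, j, k)`; for the special index the last condition is void. -/
def admissible (D : Fin n → Disk) (i j : Fin n) : Option (Fin n) → Set (Fin n)
  | some k => {h | h ∈ between i j ∧ (D h).Disj (D i) ∧ (D h).Disj (D j) ∧
      Disjoint (D h).carrier (tangentDisk D i j (some k))}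
  | none => {h | h ∈ between i j ∧ (D h).Disj (D i) ∧ (D h).Disj (D j)}

/-- The members of `admissible D i j k` that are in strongly convex position with `i` and `j`. -/
def admissibleConvex (D : Fin n → Disk) (i j : Fin n) (k : Option (Fin n)) : Set (Fin n) :=
  {h | h ∈ admissible D i j k ∧ StronglyConvex D {h, i, j}}

end

noncomputable section

variable {n : ℕ}

open Disk Filter Topology

/-! Along the bisector of $D_i$ and $D_j$, consider $F=d_h-d_i$ for a third disk $D_h$. A tangent
disk centered at a bisector point is disjoint from $D_h$ exactly when $F>0$ there, so the theorem is
about the sign changes of $F$.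

At the ends of the bisector the tangent disk degenerates to a halfplane bounded by an outer common
tangent, and $F$ tends to the difference of the support functions of $D_i$ and $D_h$ at the normal
of that tangent (`Disj.tendsto_wdist_sub_wdist`). In a strongly convex independent triple the third
disk crosses exactly one of the two tangents (`not_both_tangents_crossed`, `some_tangent_crossed`),
so $F$ has opposite signs at the ends and vanishes somewhere (`exists_equidistant`).

It vanishes only once (`equidistant_unique`): two equidistant points give a linear relation between
centers and radii of the three disks, which makes the sets of outer normals symmetric under an
involution of the unit circle with two fixed points. Each of the three connected sets contains a
fixed point, so two of them share one, and those disks intersect.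

If $D_h$ lies between $D_i$ and $D_j$, the cyclic order forces it below the upper tangent
(`supp_lt_of_between`), so $F>0$ at the upper end. Once positive at a point, $F$ cannot become
negative higher up, since that would cost two zeros (`not_wdist_lt_of_prec`). It cannot vanish at a
vertex $v_{ijk'}$ either, since four disks have no equidistant point. -/

theorem inner_eq_coords (x y : Plane) : inner ℝ x y = x 0 * y 0 + x 1 * y 1 := by
  simp [PiLp.inner_apply, Fin.sum_univ_two, mul_comm]

theorem norm_sq_eq_coords (x : Plane) : ‖x‖ ^ 2 = x 0 ^ 2 + x 1 ^ 2 := by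
  simp [EuclideanSpace.norm_sq_eq, Fin.sum_univ_two]

theorem plane_ext {x y : Plane} (h0 : x 0 = y 0) (h1 : x 1 = y 1) : x = y := by
  ext k
  fin_cases k
  · exact h0
  · exact h1

theorem coords_of_norm_eq_one {x : Plane} (hx : ‖x‖ = 1) : x 0 ^ 2 + x 1 ^ 2 = 1 := by
  rw [← norm_sq_eq_coords, hx, one_pow]

theorem continuous_cross {X : Type*} [TopologicalSpace X] {f g : X → Plane} (hf : Continuous f)
    (hg : Continuous g) : Continuous fun x => cross (f x) (g x) := by
  unfold cross
  fun_prop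

/-! ### Support functions of disks. -/

namespace Disk

/-- The support function of a disk. -/
def supp (A : Disk) (x : Plane) : ℝ := inner ℝ x A.center + A.radius

theorem inner_le_supp {A : Disk} {x q : Plane} (hx : ‖x‖ = 1) (hq : q ∈ A.carrier) :
    inner ℝ x q ≤ A.supp x := by
  have h1 : inner ℝ x (q - A.center) ≤ ‖x‖ * ‖q - A.center‖ := real_inner_le_norm _ _
  have h2 : ‖q - A.center‖ ≤ A.radius := by simpa [carrier, dist_eq_norm] using hq
  rw [hx, one_mul, inner_sub_right] at h1
  unfold supp
  linarith

theorem inner_boundary {A : Disk} {x : Plane} (hx : ‖x‖ = 1) :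
    inner ℝ x (A.center + A.radius • x) = A.supp x := by
  rw [inner_add_right, inner_smul_right, real_inner_self_eq_norm_sq, hx, supp]
  ring

theorem boundary_mem_circle {A : Disk} {x : Plane} (hx : ‖x‖ = 1) :
    A.center + A.radius • x ∈ A.circle := by
  simp [circle, norm_smul, hx, abs_of_pos A.radius_pos]

theorem circle_subset_carrier (A : Disk) : A.circle ⊆ A.carrier :=
  Metric.sphere_subset_closedBall

theorem tangentLine_supp (A : Disk) (x : Plane) : TangentLine A x (A.supp x) := by
  simp [TangentLine, supp, abs_of_pos A.radius_pos]

theorem Disj.symm {A B : Disk} (h : A.Disj B) : B.Disj A := by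
  unfold Disj at *
  rw [dist_comm]
  linarith

theorem Disj.center_ne {A B : Disk} (h : A.Disj B) : A.center ≠ B.center := by
  intro e
  unfold Disj at h
  rw [e, dist_self] at h
  linarith [A.radius_pos, B.radius_pos]

theorem Disj.notMem_of_mem {A B : Disk} (h : A.Disj B) {q : Plane} (hq : q ∈ A.carrier) :
    q ∉ B.carrier := by
  intro hq'
  simp only [carrier, Metric.mem_closedBall] at hq hq'
  have := dist_triangle_left A.center B.center q
  unfold Disj at h
  linarith

end Disk

/-! ### Arcs on the hull boundary, described by their outer normals. -/

/-- The outer normals in which the `i`-th disk is extreme among the disks with index in `S`. -/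
def normals (D : Fin n → Disk) (S : Set (Fin n)) (i : Fin n) : Set Plane :=
  {x | ‖x‖ = 1 ∧ ∀ l ∈ S, (D l).supp x ≤ (D i).supp x}

theorem carrier_subset_hull (D : Fin n → Disk) {S : Set (Fin n)} {i : Fin n} (hi : i ∈ S) :
    (D i).carrier ⊆ hull D S :=
  (subset_biUnion_of_mem (u := fun i => (D i).carrier) hi).trans (subset_convexHull ℝ _)

theorem inner_le_of_mem_hull {D : Fin n → Disk} {S : Set (Fin n)} {x q : Plane} {c : ℝ}
    (hx : ‖x‖ = 1) (hc : ∀ l ∈ S, (D l).supp x ≤ c) (hq : q ∈ hull D S) : inner ℝ x q ≤ c := by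
  have hconv : Convex ℝ {y : Plane | inner ℝ x y ≤ c} :=
    convex_halfSpace_le (innerSL ℝ x).isLinear c
  refine convexHull_min ?_ hconv hq
  intro y hy
  obtain ⟨l, hl, hy⟩ := mem_iUnion₂.1 hy
  exact (inner_le_supp hx hy).trans (hc l hl)

/-- Separating from the open interior covers boundary points and needs no closedness of the hull.
The strict inequality holds on open balls and passes to the closed disks as a weak one. -/
theorem exists_normal_of_notMem_interior {D : Fin n → Disk} {S : Set (Fin n)} (hS : S.Nonempty)
    {q : Plane} (hq : q ∉ interior (hull D S)) :
    ∃ x : Plane, ‖x‖ = 1 ∧ ∀ l ∈ S, (D l).supp x ≤ inner ℝ x q := by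
  have hconv : Convex ℝ (interior (hull D S)) := (convex_convexHull ℝ _).interior
  obtain ⟨f, hf⟩ := geometric_hahn_banach_open_point hconv isOpen_interior hq
  obtain ⟨y, rfl⟩ := (InnerProductSpace.toDual ℝ Plane).surjective f
  simp only [InnerProductSpace.toDual_apply_apply] at hf
  have hball : ∀ l ∈ S, ∀ z ∈ Metric.closedBall (D l).center (D l).radius,
      inner ℝ y z ≤ inner ℝ y q := by
    intro l hl z hz
    rw [← closure_ball _ (D l).radius_pos.ne'] at hz
    have hclosed : IsClosed {z : Plane | inner ℝ y z ≤ inner ℝ y q} :=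
      isClosed_le (by fun_prop) continuous_const
    refine closure_minimal ?_ hclosed hz
    intro w hw
    refine (hf w ?_).le
    exact interior_maximal (Metric.ball_subset_closedBall.trans (carrier_subset_hull D hl))
      Metric.isOpen_ball hw
  have hy : y ≠ 0 := by
    rintro rfl
    obtain ⟨l, hl⟩ := hS
    have hp : (D l).center ∈ interior (hull D S) :=
      interior_maximal (Metric.ball_subset_closedBall.trans (carrier_subset_hull D hl))
        Metric.isOpen_ball (Metric.mem_ball_self (D l).radius_pos)
    simpa using hf _ hp
  have hn : 0 < ‖y‖ := norm_pos_iff.2 hy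
  have hx : ‖‖y‖⁻¹ • y‖ = 1 := norm_smul_inv_norm hy
  refine ⟨‖y‖⁻¹ • y, hx, fun l hl => ?_⟩
  have := hball l hl _ (circle_subset_carrier _ (boundary_mem_circle (A := D l) hx))
  rw [← inner_boundary hx, real_inner_smul_left, real_inner_smul_left]
  gcongr

theorem contact_eq_image (D : Fin n → Disk) {S : Set (Fin n)} {i : Fin n} (hi : i ∈ S) :
    contact D S i = (fun x => (D i).center + (D i).radius • x) '' normals D S i := by
  ext q
  constructor
  · rintro ⟨hq, hf⟩
    obtain ⟨x, hx, hl⟩ := exists_normal_of_notMem_interior ⟨i, hi⟩ hf.2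
    have hr := (D i).radius_pos
    have hqn : ‖q - (D i).center‖ = (D i).radius := by
      simpa [circle, dist_eq_norm] using hq
    have h1 := hl i hi
    -- Equality in Cauchy–Schwarz forces the radius vector of `q` to be the multiple of `x` with
    -- length the radius.
    have h2 : inner ℝ x (q - (D i).center) ≥ ‖x‖ * ‖q - (D i).center‖ := by
      rw [hx, hqn, inner_sub_right]
      unfold supp at h1
      linarith
    have h3 := le_antisymm (real_inner_le_norm _ _) h2
    rw [inner_eq_norm_mul_iff_real, hx, hqn, one_smul] at h3
    have hqx : (D i).center + (D i).radius • x = q := by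
      rw [h3]
      abel
    refine ⟨x, ⟨hx, fun l hl' => ?_⟩, hqx⟩
    rw [← inner_boundary (A := D i) hx, hqx]
    exact hl l hl'
  · rintro ⟨x, ⟨hx, hl⟩, rfl⟩
    have hc := boundary_mem_circle (A := D i) hx
    refine ⟨hc, subset_closure (carrier_subset_hull D hi (circle_subset_carrier _ hc)), ?_⟩
    intro hint
    obtain ⟨ε, hε, hsub⟩ := Metric.mem_nhds_iff.1 (mem_interior_iff_mem_nhds.1 hint)
    -- A small step outward along the normal would stay in the hull but exceed its supporting line.
    have hmem := @hsub ((D i).center + (D i).radius • x + (ε / 2) • x) (by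
      simp [norm_smul, hx, abs_of_pos hε, hε])
    have := inner_le_of_mem_hull hx hl hmem
    rw [inner_add_right, inner_boundary hx, inner_smul_right, real_inner_self_eq_norm_sq, hx] at this
    linarith

/-- More disks impose more conditions on a normal. This carries points on the hull of all disks over
to the hull of a triple. -/
theorem contact_anti (D : Fin n → Disk) {S T : Set (Fin n)} (hST : S ⊆ T) {i : Fin n}
    (hi : i ∈ S) : contact D T i ⊆ contact D S i := by
  rw [contact_eq_image D hi, contact_eq_image D (hST hi)]
  exact image_mono fun x hx => ⟨hx.1, fun l hl => hx.2 l (hST hl)⟩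

theorem normals_eq_image (D : Fin n → Disk) {S : Set (Fin n)} {i : Fin n} (hi : i ∈ S) :
    normals D S i = (fun q => (D i).radius⁻¹ • (q - (D i).center)) '' contact D S i := by
  rw [contact_eq_image D hi, image_image]
  simp [smul_smul, (D i).radius_pos.ne']

theorem StronglyConvex.isConnected_normals {D : Fin n → Disk} {S : Set (Fin n)}
    (h : StronglyConvex D S) {i : Fin n} (hi : i ∈ S) : IsConnected (normals D S i) := by
  rw [normals_eq_image D hi]
  exact (h i hi).2.image _ (by fun_prop)

theorem StronglyConvex.nontrivial_normals {D : Fin n → Disk} {S : Set (Fin n)}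
    (h : StronglyConvex D S) {i : Fin n} (hi : i ∈ S) : (normals D S i).Nontrivial := by
  have := (h i hi).1
  rw [contact_eq_image D hi] at this
  exact nontrivial_of_image _ _ this

/-! ### Uniqueness of the equidistant point. -/

/-- The plane vector with components `x` and `y` in the orthonormal frame with first vector `e`. -/
def frame (e : Plane) (x y : ℝ) : Plane := !₂[x * e 0 - y * e 1, x * e 1 + y * e 0]

@[simp] theorem frame_zero (e : Plane) (x y : ℝ) : frame e x y 0 = x * e 0 - y * e 1 := rfl

@[simp] theorem frame_one (e : Plane) (x y : ℝ) : frame e x y 1 = x * e 1 + y * e 0 := rfl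

theorem frame_inner_cross {e : Plane} (he : ‖e‖ = 1) (u : Plane) :
    frame e (inner ℝ e u) (cross e u) = u := by
  have h := coords_of_norm_eq_one he
  apply plane_ext
  · simp only [frame_zero, inner_eq_coords, cross]
    linear_combination u 0 * h
  · simp only [frame_one, inner_eq_coords, cross]
    linear_combination u 1 * h

theorem inner_frame_left (e : Plane) (x y : ℝ) (p : Plane) :
    inner ℝ (frame e x y) p = x * inner ℝ e p + y * cross e p := by
  simp only [inner_eq_coords, frame_zero, frame_one, cross]
  ring

theorem inner_frame {e : Plane} (he : ‖e‖ = 1) (x y : ℝ) : inner ℝ e (frame e x y) = x := by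
  have h := coords_of_norm_eq_one he
  simp only [inner_eq_coords, frame_zero, frame_one]
  linear_combination x * h

theorem cross_frame {e : Plane} (he : ‖e‖ = 1) (x y : ℝ) : cross e (frame e x y) = y := by
  have h := coords_of_norm_eq_one he
  simp only [cross, frame_zero, frame_one]
  linear_combination y * h

theorem norm_sq_frame {e : Plane} (he : ‖e‖ = 1) (x y : ℝ) :
    ‖frame e x y‖ ^ 2 = x ^ 2 + y ^ 2 := by
  have h := coords_of_norm_eq_one he
  rw [norm_sq_eq_coords, frame_zero, frame_one]
  linear_combination (x ^ 2 + y ^ 2) * h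

theorem inner_sq_add_cross_sq {e : Plane} (he : ‖e‖ = 1) (u : Plane) :
    inner ℝ e u ^ 2 + cross e u ^ 2 = ‖u‖ ^ 2 := by
  rw [← norm_sq_frame he, frame_inner_cross he]

/-- If the disks with index in `S` satisfy a linear relation between centers and radii, then the
set of normals of each of them is invariant under a projective reflection of the unit circle. -/
theorem reflect_mem_normals {D : Fin n → Disk} {S : Set (Fin n)} {e : Plane} {κ C : ℝ}
    (he : ‖e‖ = 1) (h0 : 0 ≤ κ) (h1 : κ < 1)
    (hflat : ∀ m ∈ S, inner ℝ e (D m).center + κ * (D m).radius = C) {m : Fin n} (hm : m ∈ S)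
    {u : Plane} (hu : u ∈ normals D S m) :
    ∃ v ∈ normals D S m,
      (inner ℝ e v - κ) * (1 + κ ^ 2 - 2 * κ * inner ℝ e u) =
        -(1 - κ ^ 2) * (inner ℝ e u - κ) ∧ 0 < 1 + κ ^ 2 - 2 * κ * inner ℝ e u := by
  set x := inner ℝ e u with hx
  set y := cross e u with hy
  have hxy : x ^ 2 + y ^ 2 = 1 := by rw [hx, hy, inner_sq_add_cross_sq he, hu.1, one_pow]
  have hx1 : x ≤ 1 := by nlinarith [sq_nonneg y]
  have hden : 0 < 1 + κ ^ 2 - 2 * κ * x := by nlinarith [mul_nonneg h0 (sub_nonneg.2 hx1)]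
  set d := 1 + κ ^ 2 - 2 * κ * x with hd
  have hμ : 0 < (1 - κ ^ 2) / d := div_pos (by nlinarith) hden
  -- The term `x * C` is common to all disks and `1 - κ * x` is positive, so which disk is extreme
  -- depends only on the ratio of `y` to `1 - κ * x`.
  have hs : ∀ x y : ℝ, ∀ l ∈ S, (D l).supp (frame e x y) =
      x * C + (y * cross e (D l).center + (D l).radius * (1 - κ * x)) := by
    intro x y l hl
    rw [supp, inner_frame_left, ← hflat l hl]
    ring
  -- Directions with the same ratio lie on a line through the pole $(1/\kappa,0)$ (parallel to `e`
  -- if `κ = 0`); the witness is the second intersection of that line with the unit circle.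
  refine ⟨frame e ((2 * κ - (1 + κ ^ 2) * x) / d) (y * ((1 - κ ^ 2) / d)), ⟨?_, ?_⟩, ?_, hden⟩
  · rw [← pow_eq_one_iff_of_nonneg (norm_nonneg _) two_ne_zero, norm_sq_frame he]
    field_simp
    rw [hd]
    linear_combination (1 - κ ^ 2) ^ 2 * hxy
  · intro l hl
    have hul := hu.2 l hl
    rw [← frame_inner_cross he u, ← hx, ← hy, hs _ _ l hl, hs _ _ m hm, add_le_add_iff_left] at hul
    rw [hs _ _ l hl, hs _ _ m hm, add_le_add_iff_left]
    have hk : 1 - κ * ((2 * κ - (1 + κ ^ 2) * x) / d) = (1 - κ ^ 2) / d * (1 - κ * x) := by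
      field_simp
      rw [hd]
      ring
    rw [hk]
    have := mul_le_mul_of_nonneg_left hul hμ.le
    linarith
  · rw [inner_frame he]
    field_simp
    rw [hd]
    ring

/-- A normal and its reflection lie on opposite sides of the polar line where the `e`-component is
`κ`, so the connected set of normals meets that line, whose points on the circle are the fixed
points. -/
theorem exists_fixed_mem_normals {D : Fin n → Disk} {S : Set (Fin n)} {e : Plane} {κ C : ℝ}
    (he : ‖e‖ = 1) (h0 : 0 ≤ κ) (h1 : κ < 1)
    (hflat : ∀ m ∈ S, inner ℝ e (D m).center + κ * (D m).radius = C)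
    (hS : StronglyConvex D S) {m : Fin n} (hm : m ∈ S) :
    ∃ f ∈ normals D S m, inner ℝ e f = κ := by
  have hconn := hS.isConnected_normals hm
  obtain ⟨u, hu⟩ := hconn.nonempty
  obtain ⟨v, hv, huv, hden⟩ := reflect_mem_normals he h0 h1 hflat hm hu
  have hκ : 0 < 1 - κ ^ 2 := by nlinarith
  have hcont : ContinuousOn (fun z : Plane => inner ℝ e z) (normals D S m) :=
    (by fun_prop : Continuous fun z : Plane => inner ℝ e z).continuousOn
  rcases le_total (inner ℝ e u) κ with h | h
  · have hv' : κ ≤ inner ℝ e v := by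
      by_contra! hlt
      nlinarith [mul_pos (sub_pos.2 hlt) hden, mul_nonneg hκ.le (sub_nonneg.2 h)]
    exact hconn.isPreconnected.intermediate_value hu hv hcont ⟨h, hv'⟩
  · have hv' : inner ℝ e v ≤ κ := by
      by_contra! hlt
      nlinarith [mul_pos (sub_pos.2 hlt) hden, mul_nonneg hκ.le (sub_nonneg.2 h)]
    exact hconn.isPreconnected.intermediate_value hv hu hcont ⟨hv', h⟩

/-- The linear relation and the equal supports determine the difference of the centers: the disks
touch their common supporting line at the same point, so one contains the other. -/
theorem not_disj_of_common_normal {A B : Disk} {e f : Plane} {κ C : ℝ} (he : ‖e‖ = 1)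
    (h0 : 0 ≤ κ) (h1 : κ < 1) (hA : inner ℝ e A.center + κ * A.radius = C)
    (hB : inner ℝ e B.center + κ * B.radius = C) (hf : ‖f‖ = 1) (hef : inner ℝ e f = κ)
    (hAB : A.supp f = B.supp f) : ¬ A.Disj B := by
  have hxy := inner_sq_add_cross_sq he f
  rw [hef, hf] at hxy
  have hy : cross e f ≠ 0 := by
    intro h
    rw [h] at hxy
    nlinarith
  have hrel : A.center - B.center = (B.radius - A.radius) • f := by
    rw [← frame_inner_cross he (A.center - B.center)]
    rw [← frame_inner_cross he f] at hAB ⊢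
    simp only [supp, inner_frame_left] at hAB
    rw [hef] at hAB ⊢
    have hi : inner ℝ e (A.center - B.center) = (B.radius - A.radius) * κ := by
      rw [inner_sub_right]
      linarith
    have hc : cross e (A.center - B.center) = (B.radius - A.radius) * cross e f := by
      have hsub : cross e (A.center - B.center) = cross e A.center - cross e B.center := by
        simp only [cross, PiLp.sub_apply]
        ring
      apply mul_left_cancel₀ hy
      rw [hsub]
      linear_combination hAB + κ * (hB - hA) + (A.radius - B.radius) * hxy
    rw [hi, hc]
    apply plane_ext
    · simp only [frame_zero, PiLp.smul_apply, smul_eq_mul]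
      ring
    · simp only [frame_one, PiLp.smul_apply, smul_eq_mul]
      ring
  unfold Disj
  rw [dist_eq_norm, hrel, norm_smul, hf, mul_one, not_lt, Real.norm_eq_abs, abs_le]
  constructor <;> linarith [A.radius_pos, B.radius_pos]

/-- Strongly convex independent disks, three of which are given, satisfy no linear relation between
centers and radii. -/
theorem not_flat {D : Fin n → Disk} {i j k : Fin n} (hij : i ≠ j) (hik : i ≠ k) (hjk : j ≠ k)
    (hS : StronglyConvex D {i, j, k}) (hI : Independent D {i, j, k}) {e : Plane} {κ C : ℝ}
    (he : ‖e‖ = 1) (h0 : 0 ≤ κ) (h1 : κ < 1) :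
    ¬ ∀ m ∈ ({i, j, k} : Set (Fin n)), inner ℝ e (D m).center + κ * (D m).radius = C := by
  intro hflat
  have hi : i ∈ ({i, j, k} : Set (Fin n)) := by simp
  have hj : j ∈ ({i, j, k} : Set (Fin n)) := by simp
  have hk : k ∈ ({i, j, k} : Set (Fin n)) := by simp
  have key : ∀ a ∈ ({i, j, k} : Set (Fin n)), ∀ b ∈ ({i, j, k} : Set (Fin n)), a ≠ b →
      ∀ f ∈ normals D {i, j, k} a, inner ℝ e f = κ → f ∉ normals D {i, j, k} b := by
    intro a ha b hb hab f hfa hef hfb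
    exact not_disj_of_common_normal he h0 h1 (hflat a ha) (hflat b hb) hfa.1 hef
      (le_antisymm (hfb.2 a ha) (hfa.2 b hb)) (hI a ha b hb hab)
  obtain ⟨f, hf, hef⟩ := exists_fixed_mem_normals he h0 h1 hflat hS hi
  obtain ⟨g, hg, heg⟩ := exists_fixed_mem_normals he h0 h1 hflat hS hj
  obtain ⟨l, hl, hel⟩ := exists_fixed_mem_normals he h0 h1 hflat hS hk
  -- Only two unit vectors have `e`-component `κ`, and they differ in the sign of the cross product
  -- with `e`. Three pairwise distinct ones cannot exist.
  have hcross : ∀ x y : Plane, ‖x‖ = 1 → ‖y‖ = 1 → inner ℝ e x = κ → inner ℝ e y = κ → x ≠ y →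
      cross e x = - cross e y := by
    intro x y hx hy hex hey hne
    have h1 := inner_sq_add_cross_sq he x
    have h2 := inner_sq_add_cross_sq he y
    rw [hex, hx] at h1
    rw [hey, hy] at h2
    rcases sq_eq_sq_iff_eq_or_eq_neg.1 (show cross e x ^ 2 = cross e y ^ 2 by linarith) with h | h
    · exact absurd (by rw [← frame_inner_cross he x, ← frame_inner_cross he y, h, hex, hey]) hne
    · exact h
  have hfg : f ≠ g := fun h => key i hi j hj hij f hf hef (h ▸ hg)
  have hfl : f ≠ l := fun h => key i hi k hk hik f hf hef (h ▸ hl)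
  have hgl : g ≠ l := fun h => key j hj k hk hjk g hg heg (h ▸ hl)
  have e1 := hcross f g hf.1 hg.1 hef heg hfg
  have e2 := hcross f l hf.1 hl.1 hef hel hfl
  apply hgl
  rw [← frame_inner_cross he g, ← frame_inner_cross he l, heg, hel,
    show cross e g = cross e l by linarith]

/-- Three disks in strongly convex position have at most one equidistant point. -/
theorem equidistant_unique {D : Fin n → Disk} (hgen : GeneralPosition D) {i j k : Fin n}
    (hij : i ≠ j) (hik : i ≠ k) (hjk : j ≠ k)
    (hS : StronglyConvex D {i, j, k}) (hI : Independent D {i, j, k}) {v w : Plane}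
    (hv : Equidistant D i j k v) (hw : Equidistant D i j k w) : v = w := by
  -- This ordering makes the coefficient `κ = (ρ' - ρ) / s` nonnegative.
  wlog hle : (D i).wdist v ≤ (D i).wdist w generalizing v w
  · exact (this hw hv (le_of_not_ge hle)).symm
  by_contra hne
  have hvm : ∀ m ∈ ({i, j, k} : Set (Fin n)), dist (D m).center v = (D m).radius + (D i).wdist v := by
    rintro m (rfl | rfl | rfl)
    · simp [wdist]
    · rw [hv.1]; simp [wdist]
    · rw [hv.2]; simp [wdist]
  have hwm : ∀ m ∈ ({i, j, k} : Set (Fin n)), dist (D m).center w = (D m).radius + (D i).wdist w := by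
    rintro m (rfl | rfl | rfl)
    · simp [wdist]
    · rw [hw.1]; simp [wdist]
    · rw [hw.2]; simp [wdist]
  set ρ := (D i).wdist v
  set ρ' := (D i).wdist w
  set s := dist v w with hs
  have hspos : 0 < s := dist_pos.2 hne
  have hi : i ∈ ({i, j, k} : Set (Fin n)) := by simp
  have hδ : ρ' - ρ ≤ s := by
    have := dist_triangle (D i).center v w
    rw [hvm i hi, hwm i hi] at this
    linarith
  set e : Plane := s⁻¹ • (w - v) with he'
  have he : ‖e‖ = 1 := by
    rw [he', norm_smul, norm_inv, ← dist_eq_norm, dist_comm w v, ← hs, Real.norm_of_nonneg hspos.le]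
    exact inv_mul_cancel₀ hspos.ne'
  -- Subtracting the squared distance equations for `v` and `w` cancels the quadratic terms in the
  -- center and in the radius.
  have hrel : ∀ m ∈ ({i, j, k} : Set (Fin n)),
      inner ℝ e (D m).center + (ρ' - ρ) / s * (D m).radius =
        (‖w‖ ^ 2 - ‖v‖ ^ 2 - ρ' ^ 2 + ρ ^ 2) / (2 * s) := by
    intro m hm
    have h1 := hvm m hm
    have h2 := hwm m hm
    have h3 : ‖(D m).center - v‖ ^ 2 = ((D m).radius + ρ) ^ 2 := by rw [← h1, dist_eq_norm]
    have h4 : ‖(D m).center - w‖ ^ 2 = ((D m).radius + ρ') ^ 2 := by rw [← h2, dist_eq_norm]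
    rw [norm_sub_sq_real] at h3 h4
    rw [he', real_inner_smul_left, inner_sub_left, real_inner_comm _ w, real_inner_comm _ v]
    field_simp
    linear_combination h3 - h4
  rcases hδ.lt_or_eq with hlt | heq
  · exact not_flat hij hik hjk hS hI he (div_nonneg (sub_nonneg.2 hle) hspos.le)
      ((div_lt_one hspos).2 hlt) hrel
  -- For `κ = 1` the relation says that one line is tangent to all three disks.
  · rw [heq, div_self hspos.ne'] at hrel
    simp only [one_mul] at hrel
    have ht : ∀ m ∈ ({i, j, k} : Set (Fin n)), TangentLine (D m) e
        ((‖w‖ ^ 2 - ‖v‖ ^ 2 - ρ' ^ 2 + ρ ^ 2) / (2 * s)) := by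
      intro m hm
      rw [← hrel m hm]
      exact tangentLine_supp _ _
    exact hgen.no_tangent i j k hij hik hjk ⟨e, _, he, ht i (by simp), ht j (by simp),
      ht k (by simp)⟩

/-! ### Separation on the unit circle, and which outer tangents a third disk crosses. -/

theorem norm_sq_mul_cross (d a z : Plane) :
    ‖d‖ ^ 2 * cross a z = inner ℝ d z * cross a d + cross d z * inner ℝ d a := by
  simp only [norm_sq_eq_coords, inner_eq_coords, cross]
  ring

theorem norm_sq_mul_norm_sq (d z : Plane) :
    ‖d‖ ^ 2 * ‖z‖ ^ 2 = inner ℝ d z ^ 2 + cross d z ^ 2 := by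
  simp only [norm_sq_eq_coords, inner_eq_coords, cross]
  ring

/-- A line meets a circle in at most two points: $z-x$ and $z-y$ turn out both orthogonal and
parallel, so one of them is zero. -/
theorem eq_or_eq_of_cross_eq_zero {x y z : Plane} (hx : ‖x‖ = 1) (hy : ‖y‖ = 1) (hz : ‖z‖ = 1)
    (hxy : x ≠ y) (h : cross (y - x) (z - x) = 0) : z = x ∨ z = y := by
  have hx' := coords_of_norm_eq_one hx
  have hy' := coords_of_norm_eq_one hy
  have hz' := coords_of_norm_eq_one hz
  have hne : ‖y - x‖ ^ 2 ≠ 0 := pow_ne_zero _ (norm_ne_zero_iff.2 (sub_ne_zero.2 hxy.symm))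
  have hprod : ‖z - x‖ ^ 2 * ‖z - y‖ ^ 2 = 0 := by
    rw [norm_sq_mul_norm_sq]
    have h1 : inner ℝ (z - x) (z - y) = 0 := by
      apply mul_left_cancel₀ hne
      simp only [norm_sq_eq_coords, inner_eq_coords, cross, PiLp.sub_apply] at h ⊢
      have e : 2 * (x 0 * (y 0 - x 0) + x 1 * (y 1 - x 1)) +
        ((y 0 - x 0) ^ 2 + (y 1 - x 1) ^ 2) = 0 := by linear_combination hy' - hx'
      have e' : 2 * (x 0 * (z 0 - x 0) + x 1 * (z 1 - x 1)) +
        ((z 0 - x 0) ^ 2 + (z 1 - x 1) ^ 2) = 0 := by linear_combination hz' - hx'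
      linear_combination ((y 0 - x 0) ^ 2 + (y 1 - x 1) ^ 2) * e' -
        ((y 0 - x 0) * (z 0 - x 0) + (y 1 - x 1) * (z 1 - x 1)) * e +
        2 * (x 0 * (y 1 - x 1) - x 1 * (y 0 - x 0)) * h
    have h2 : cross (z - x) (z - y) = 0 := by
      simp only [cross, PiLp.sub_apply] at h ⊢
      linear_combination h
    rw [h1, h2]
    ring
  rcases mul_eq_zero.1 hprod with h | h
  · left
    simpa [sub_eq_zero] using h
  · right
    simpa [sub_eq_zero] using h

theorem opposite_of_combination_eq_zero {p q a b : ℝ} (hp : 0 ≤ p) (hq : 0 ≤ q) (hpq : 0 < p + q)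
    (h : p * a + q * b = 0) : (a ≤ 0 ∧ 0 ≤ b) ∨ (b ≤ 0 ∧ 0 ≤ a) := by
  rcases le_total a 0 with ha | ha <;> rcases le_total b 0 with hb | hb
  · have h1 : p * a = 0 := by
      linarith [mul_nonpos_of_nonneg_of_nonpos hp ha, mul_nonpos_of_nonneg_of_nonpos hq hb]
    have h2 : q * b = 0 := by linarith
    rcases mul_eq_zero.1 h1 with rfl | rfl
    · rcases mul_eq_zero.1 h2 with rfl | rfl
      · simp at hpq
      · exact Or.inl ⟨ha, hb⟩
    · exact Or.inr ⟨hb, ha⟩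
  · exact Or.inl ⟨ha, hb⟩
  · exact Or.inr ⟨hb, ha⟩
  · have h1 : p * a = 0 := by linarith [mul_nonneg hp ha, mul_nonneg hq hb]
    have h2 : q * b = 0 := by linarith
    rcases mul_eq_zero.1 h1 with rfl | rfl
    · rcases mul_eq_zero.1 h2 with rfl | rfl
      · simp at hpq
      · exact Or.inr ⟨hb, ha⟩
    · exact Or.inl ⟨ha, hb⟩

/-- A connected part of the unit circle containing two points `u` and `w` contains one of any two
points that are separated by the line through `u` and `w`. -/
theorem mem_or_mem_of_separated {V : Set Plane} (hV : ∀ z ∈ V, ‖z‖ = 1) (hpre : IsPreconnected V)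
    {d u w x y : Plane} {t : ℝ} (hu : u ∈ V) (hw : w ∈ V) (hdu : inner ℝ d u = t)
    (hdw : inner ℝ d w = t) (hcu : 0 < cross d u) (hcw : cross d w < 0) (hx : ‖x‖ = 1)
    (hy : ‖y‖ = 1) (hdx : t < inner ℝ d x) (hdy : inner ℝ d y < t) : x ∈ V ∨ y ∈ V := by
  have hxy : x ≠ y := by
    rintro rfl
    linarith
  have hd : d ≠ 0 := by
    rintro rfl
    simp [cross] at hcu
  have hd2 : 0 < ‖d‖ ^ 2 := pow_pos (norm_pos_iff.2 hd) 2
  set L : Plane → ℝ := fun z => cross (y - x) (z - x) with hL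
  have hcont : Continuous L := continuous_cross (by fun_prop) (by fun_prop)
  have hLd : ∀ z, inner ℝ d z = t → ‖d‖ ^ 2 * L z =
      t * cross (y - x) d + cross d z * inner ℝ d (y - x) - ‖d‖ ^ 2 * cross (y - x) x := by
    intro z hz
    rw [← hz, ← norm_sq_mul_cross]
    simp only [hL, cross, PiLp.sub_apply]
    ring
  have hden : 0 < inner ℝ d x - inner ℝ d y := by linarith
  set lam := (inner ℝ d x - t) / (inner ℝ d x - inner ℝ d y) with hlam
  have hlam0 : 0 ≤ lam := div_nonneg (by linarith) hden.le
  have hlam1 : lam ≤ 1 := (div_le_one hden).2 (by linarith)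
  -- `z` is where the chord from `x` to `y` meets the line through `u` and `w`. Being in the unit
  -- disk, it lies between `u` and `w`, so `L`, which vanishes on the line through `x` and `y`,
  -- takes opposite weak signs at `u` and `w`.
  set z : Plane := (1 - lam) • x + lam • y with hz
  have hzn : ‖z‖ ≤ 1 := by
    refine (norm_add_le _ _).trans ?_
    rw [norm_smul, norm_smul, hx, hy, Real.norm_of_nonneg hlam0,
      Real.norm_of_nonneg (sub_nonneg.2 hlam1)]
    linarith
  have hdz : inner ℝ d z = t := by
    rw [hz, inner_add_right, inner_smul_right, inner_smul_right]
    have : lam * (inner ℝ d x - inner ℝ d y) = inner ℝ d x - t := div_mul_cancel₀ _ hden.ne'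
    linarith
  have hLz : L z = 0 := by
    simp only [hL, hz, cross, PiLp.sub_apply, PiLp.add_apply, PiLp.smul_apply, smul_eq_mul]
    ring
  have n1 := norm_sq_mul_norm_sq d u
  have n2 := norm_sq_mul_norm_sq d w
  have n3 := norm_sq_mul_norm_sq d z
  rw [hV u hu, hdu] at n1
  rw [hV w hw, hdw] at n2
  rw [hdz] at n3
  have hz2 : ‖z‖ ^ 2 ≤ 1 := pow_le_one₀ (norm_nonneg _) hzn
  have hz3 : ‖d‖ ^ 2 * ‖z‖ ^ 2 ≤ ‖d‖ ^ 2 := by nlinarith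
  have b1 : cross d z ≤ cross d u := abs_le_of_sq_le_sq' (by linarith) hcu.le |>.2
  have b2 : cross d w ≤ cross d z := by
    have := (abs_le_of_sq_le_sq' (a := cross d z) (b := -cross d w) (by nlinarith)
      (by linarith)).1
    linarith
  have hcomb : (cross d z - cross d w) * L u + (cross d u - cross d z) * L w = 0 := by
    apply mul_left_cancel₀ hd2.ne'
    have e1 := hLd u hdu
    have e2 := hLd w hdw
    have e3 := hLd z hdz
    rw [hLz] at e3
    linear_combination (cross d z - cross d w) * e1 + (cross d u - cross d z) * e2 -
      (cross d u - cross d w) * e3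
  have hzero : ∃ v ∈ V, L v = 0 := by
    rcases opposite_of_combination_eq_zero (sub_nonneg.2 b2) (sub_nonneg.2 b1) (by linarith) hcomb
      with h | h
    · exact hpre.intermediate_value hu hw hcont.continuousOn h
    · exact hpre.intermediate_value hw hu hcont.continuousOn h
  obtain ⟨v, hv, h0⟩ := hzero
  rcases eq_or_eq_of_cross_eq_zero hx hy (hV v hv) hxy h0 with rfl | rfl
  · exact Or.inl hv
  · exact Or.inr hv

theorem finite_unit_inner_eq {d : Plane} (hd : d ≠ 0) (t : ℝ) :
    {x : Plane | ‖x‖ = 1 ∧ inner ℝ d x = t}.Finite := by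
  rcases ({x : Plane | ‖x‖ = 1 ∧ inner ℝ d x = t}).eq_empty_or_nonempty with h | ⟨x, hx, hdx⟩
  · rw [h]
    exact finite_empty
  by_cases hsub : {x : Plane | ‖x‖ = 1 ∧ inner ℝ d x = t} ⊆ {x}
  · exact (finite_singleton x).subset hsub
  obtain ⟨y, ⟨hy, hdy⟩, hyx⟩ := not_subset.1 hsub
  refine ((finite_singleton y).insert x).subset ?_
  rintro z ⟨hz, hdz⟩
  refine eq_or_eq_of_cross_eq_zero hx hy hz (Ne.symm hyx) ?_
  have hd2 : ‖d‖ ^ 2 ≠ 0 := pow_ne_zero _ (norm_ne_zero_iff.2 hd)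
  apply mul_left_cancel₀ hd2
  rw [norm_sq_mul_cross, inner_sub_right, inner_sub_right, hdx, hdy, hdz]
  ring

/-- Every disk is the only extreme one in some direction, in which the values of the support
functions are distinct. -/
theorem exists_generic_normal {D : Fin n → Disk} {S : Set (Fin n)} (hS : StronglyConvex D S)
    (hI : Independent D S) {m : Fin n} (hm : m ∈ S) :
    ∃ x ∈ normals D S m, ∀ a ∈ S, ∀ b ∈ S, a ≠ b → (D a).supp x ≠ (D b).supp x := by
  -- An arc of normals is infinite, whereas two disks with distinct centers have equal supports in
  -- only finitely many directions.
  have hinf : (normals D S m).Infinite :=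
    (hS.isConnected_normals hm).isPreconnected.infinite_of_nontrivial (hS.nontrivial_normals hm)
  have hfin : (⋃ a : Fin n, ⋃ b : Fin n, {x : Plane | ‖x‖ = 1 ∧ (a ∈ S ∧ b ∈ S ∧ a ≠ b ∧
      (D a).supp x = (D b).supp x)}).Finite := by
    refine finite_iUnion fun a => finite_iUnion fun b => ?_
    by_cases h : a ∈ S ∧ b ∈ S ∧ a ≠ b
    · refine (finite_unit_inner_eq (sub_ne_zero.2 (hI a h.1 b h.2.1 h.2.2).center_ne)
        ((D b).radius - (D a).radius)).subset ?_
      rintro x ⟨hx, -, -, -, hab⟩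
      refine ⟨hx, ?_⟩
      rw [real_inner_comm, inner_sub_right]
      unfold supp at hab
      linarith
    · refine finite_empty.subset ?_
      rintro x ⟨-, ha, hb, hab, -⟩
      exact h ⟨ha, hb, hab⟩
  obtain ⟨x, hx, hx'⟩ := hinf.exists_notMem_finite hfin
  refine ⟨x, hx, fun a ha b hb hab h => hx' ?_⟩
  exact mem_iUnion.2 ⟨a, mem_iUnion.2 ⟨b, hx.1, ha, hb, hab, h⟩⟩

theorem exists_strict_normal {D : Fin n → Disk} {S : Set (Fin n)} (hS : StronglyConvex D S)
    (hI : Independent D S) {m : Fin n} (hm : m ∈ S) :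
    ∃ x : Plane, ‖x‖ = 1 ∧ (∀ a ∈ S, a ≠ m → (D a).supp x < (D m).supp x) ∧
      ∀ a ∈ S, ∀ b ∈ S, a ≠ b → (D a).supp x ≠ (D b).supp x := by
  obtain ⟨x, hx, hne⟩ := exists_generic_normal hS hI hm
  exact ⟨x, hx.1, fun a ha ham => lt_of_le_of_ne (hx.2 a ha) (hne a ha m hm ham), hne⟩

/-- `u` is the unit normal of an outer common tangent line of the disks `A` and `B`. -/
def OuterNormal (A B : Disk) (u : Plane) : Prop := ‖u‖ = 1 ∧ A.supp u = B.supp u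

theorem OuterNormal.inner_eq {A B : Disk} {u : Plane} (h : OuterNormal A B u) :
    inner ℝ (B.center - A.center) u = A.radius - B.radius := by
  have := h.2
  unfold supp at this
  rw [real_inner_comm, inner_sub_right]
  linarith

theorem supp_lt_iff {A B : Disk} {x : Plane} : A.supp x < B.supp x ↔
    A.radius - B.radius < inner ℝ (B.center - A.center) x := by
  unfold supp
  rw [inner_sub_left, real_inner_comm x B.center, real_inner_comm x A.center]
  constructor <;> intro h <;> linarith

theorem supp_lt_iff' {A B : Disk} {x : Plane} : B.supp x < A.supp x ↔
    inner ℝ (B.center - A.center) x < A.radius - B.radius := by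
  unfold supp
  rw [inner_sub_left, real_inner_comm x B.center, real_inner_comm x A.center]
  constructor <;> intro h <;> linarith

section Triple

variable {D : Fin n → Disk} {S : Set (Fin n)} {i j m : Fin n} {u w : Plane}

/-- Otherwise both tangent normals are normals of `m`. They separate the directions favoring `j`
over `i` from those favoring `i`, so the connected set of normals of `m` would swallow a direction
in which `j` or `i` alone is extreme. -/
theorem not_both_tangents_crossed (hS : StronglyConvex D S) (hI : Independent D S)
    (hsub : S ⊆ {i, j, m}) (hi : i ∈ S) (hj : j ∈ S) (hm : m ∈ S) (hij : i ≠ j) (him : i ≠ m)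
    (hjm : j ≠ m) (hu : OuterNormal (D i) (D j) u) (hw : OuterNormal (D i) (D j) w)
    (hcu : 0 < cross ((D j).center - (D i).center) u)
    (hcw : cross ((D j).center - (D i).center) w < 0) :
    ¬ ((D i).supp u ≤ (D m).supp u ∧ (D i).supp w ≤ (D m).supp w) := by
  rintro ⟨h1, h2⟩
  have hmem : ∀ z, OuterNormal (D i) (D j) z → (D i).supp z ≤ (D m).supp z →
      z ∈ normals D S m := by
    intro z hz hle
    refine ⟨hz.1, fun l hl => ?_⟩
    rcases hsub hl with rfl | rfl | rfl
    · exact hle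
    · rw [← hz.2]; exact hle
    · exact le_rfl
  obtain ⟨x, hx, hxs, -⟩ := exists_strict_normal hS hI hj
  obtain ⟨y, hy, hys, -⟩ := exists_strict_normal hS hI hi
  rcases mem_or_mem_of_separated (V := normals D S m) (fun z hz => hz.1)
    (hS.isConnected_normals hm).isPreconnected (hmem u hu h1) (hmem w hw h2) hu.inner_eq
    hw.inner_eq hcu hcw hx hy (supp_lt_iff.1 (hxs i hi hij))
    (supp_lt_iff'.1 (hys j hj hij.symm)) with h | h
  · exact absurd (h.2 j hj) (not_le.2 (hxs m hm hjm.symm))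
  · exact absurd (h.2 i hi) (not_le.2 (hys m hm him.symm))

/-- Otherwise both tangent normals belong to `i` and to `j`. A direction in which `m` alone is
extreme favors one of these two, and the connected normals of that one must contain this direction
or one belonging to the other disk alone. -/
theorem some_tangent_crossed (hS : StronglyConvex D S) (hI : Independent D S)
    (hsub : S ⊆ {i, j, m}) (hi : i ∈ S) (hj : j ∈ S) (hm : m ∈ S) (hij : i ≠ j) (him : i ≠ m)
    (hjm : j ≠ m) (hu : OuterNormal (D i) (D j) u) (hw : OuterNormal (D i) (D j) w)
    (hcu : 0 < cross ((D j).center - (D i).center) u)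
    (hcw : cross ((D j).center - (D i).center) w < 0) :
    ¬ ((D m).supp u ≤ (D i).supp u ∧ (D m).supp w ≤ (D i).supp w) := by
  rintro ⟨h1, h2⟩
  have hmem : ∀ z, OuterNormal (D i) (D j) z → (D m).supp z ≤ (D i).supp z →
      z ∈ normals D S i ∧ z ∈ normals D S j := by
    intro z hz hle
    refine ⟨⟨hz.1, fun l hl => ?_⟩, ⟨hz.1, fun l hl => ?_⟩⟩
    · rcases hsub hl with rfl | rfl | rfl
      · exact le_rfl
      · exact hz.2.ge
      · exact hle
    · rcases hsub hl with rfl | rfl | rfl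
      · exact hz.2.le
      · exact le_rfl
      · rw [← hz.2]; exact hle
  obtain ⟨x, hx, hxs, hxg⟩ := exists_strict_normal hS hI hm
  rcases (hxg i hi j hj hij).lt_or_gt with hlt | hlt
  · obtain ⟨y, hy, hys, -⟩ := exists_strict_normal hS hI hi
    rcases mem_or_mem_of_separated (V := normals D S j) (fun z hz => hz.1)
      (hS.isConnected_normals hj).isPreconnected (hmem u hu h1).2 (hmem w hw h2).2 hu.inner_eq
      hw.inner_eq hcu hcw hx hy (supp_lt_iff.1 hlt) (supp_lt_iff'.1 (hys j hj hij.symm)) with h | h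
    · exact absurd (h.2 m hm) (not_le.2 (hxs j hj hjm))
    · exact absurd (h.2 i hi) (not_le.2 (hys j hj hij.symm))
  · obtain ⟨y, hy, hys, -⟩ := exists_strict_normal hS hI hj
    rcases mem_or_mem_of_separated (V := normals D S i) (fun z hz => hz.1)
      (hS.isConnected_normals hi).isPreconnected (hmem u hu h1).1 (hmem w hw h2).1 hu.inner_eq
      hw.inner_eq hcu hcw hy hx (supp_lt_iff.1 (hys i hi hij)) (supp_lt_iff'.1 hlt) with h | h
    · exact absurd (h.2 j hj) (not_le.2 (hys i hi hij))
    · exact absurd (h.2 m hm) (not_le.2 (hxs i hi him))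

end Triple

/-! ### Cyclic order and the position of a disk relative to the upper tangent. -/

/-- Twice the signed area of a triangle; it is positive if the vertices are in counterclockwise
order. -/
def orient (a b c : Plane) : ℝ := cross (b - a) (c - a)

theorem wbtw_of_orient_eq_zero {a b c : Plane} (h : orient a b c = 0) :
    Wbtw ℝ a b c ∨ Wbtw ℝ b c a ∨ Wbtw ℝ c a b := by
  by_cases hab : b = a
  · left
    rw [hab]
    exact wbtw_self_left ℝ a c
  apply Collinear.wbtw_or_wbtw_or_wbtw
  rw [collinear_iff_of_mem (p₀ := a) (by simp)]
  refine ⟨b - a, ?_⟩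
  have hne : ‖b - a‖ ^ 2 ≠ 0 := pow_ne_zero _ (norm_ne_zero_iff.2 (sub_ne_zero.2 hab))
  rintro p (rfl | rfl | rfl)
  · exact ⟨0, by simp⟩
  · exact ⟨1, by simp⟩
  · refine ⟨inner ℝ (b - a) (p - a) / ‖b - a‖ ^ 2, ?_⟩
    rw [vadd_eq_add, ← sub_eq_iff_eq_add]
    simp only [norm_sq_eq_coords] at hne ⊢
    simp only [orient, cross] at h
    apply plane_ext
    · rw [PiLp.smul_apply, inner_eq_coords, smul_eq_mul]
      field_simp
      linear_combination -(b - a) 1 * h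
    · rw [PiLp.smul_apply, inner_eq_coords, smul_eq_mul]
      field_simp
      linear_combination (b - a) 0 * h

theorem contact_subset_carrier (D : Fin n → Disk) (S : Set (Fin n)) (i : Fin n) :
    contact D S i ⊆ (D i).carrier := fun _ hq => circle_subset_carrier _ hq.1

theorem GeneralPosition.not_supp_eq {D : Fin n → Disk} (hgen : GeneralPosition D) {a b c : Fin n}
    (hab : a ≠ b) (hac : a ≠ c) (hbc : b ≠ c) {x : Plane} {t : ℝ} (hx : ‖x‖ = 1)
    (ha : (D a).supp x = t) (hb : (D b).supp x = t) (hc : (D c).supp x = t) : False :=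
  hgen.no_tangent a b c hab hac hbc ⟨x, t, hx, ha ▸ tangentLine_supp _ _,
    hb ▸ tangentLine_supp _ _, hc ▸ tangentLine_supp _ _⟩

/-- A supporting line at the middle point has the outer two points on its inner side, so it contains
them and is tangent to three disks. Disjointness excludes coinciding points. -/
theorem not_wbtw_contact {D : Fin n → Disk} (hgen : GeneralPosition D) {S : Set (Fin n)}
    (hI : Independent D S) {a b c : Fin n} (ha : a ∈ S) (hb : b ∈ S) (hc : c ∈ S) (hab : a ≠ b)
    (hac : a ≠ c) (hbc : b ≠ c) {p q r : Plane} (hp : p ∈ (D a).carrier) (hq : q ∈ contact D S b)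
    (hr : r ∈ (D c).carrier) : ¬ Wbtw ℝ p q r := by
  intro hw
  have hqb := contact_subset_carrier _ _ _ hq
  rw [contact_eq_image D hb] at hq
  obtain ⟨x, ⟨hx, hxl⟩, hxq⟩ := hq
  have e1 : inner ℝ x q = (D b).supp x := by
    rw [← hxq]
    exact inner_boundary hx
  have e2 := inner_le_supp hx hp
  have e3 := inner_le_supp hx hr
  have e4 := hxl a ha
  have e5 := hxl c hc
  obtain ⟨s, t, hs, ht, hst, hq⟩ := mem_segment_iff_wbtw.2 hw
  rcases hs.eq_or_lt with rfl | hs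
  · have : r = q := by
      rw [← hq, show t = 1 by linarith]
      simp
    exact (hI b hb c hc hbc).notMem_of_mem hqb (this ▸ hr)
  rcases ht.eq_or_lt with rfl | ht
  · have : p = q := by
      rw [← hq, show s = 1 by linarith]
      simp
    exact (hI b hb a ha hab.symm).notMem_of_mem hqb (this ▸ hp)
  rw [← hq, inner_add_right, inner_smul_right, inner_smul_right] at e1
  have hcomb : s * ((D b).supp x - inner ℝ x p) + t * ((D b).supp x - inner ℝ x r) = 0 := by
    linear_combination (D b).supp x * hst - e1
  have h1 : 0 ≤ s * ((D b).supp x - inner ℝ x p) := mul_nonneg hs.le (by linarith)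
  have h2 : 0 ≤ t * ((D b).supp x - inner ℝ x r) := mul_nonneg ht.le (by linarith)
  have h3 := (mul_eq_zero.1 (by linarith : s * ((D b).supp x - inner ℝ x p) = 0)).resolve_left hs.ne'
  have h4 := (mul_eq_zero.1 (by linarith : t * ((D b).supp x - inner ℝ x r) = 0)).resolve_left ht.ne'
  exact hgen.not_supp_eq hab hac hbc hx (t := (D b).supp x) (by linarith) rfl (by linarith)

theorem orient_contact_ne_zero {D : Fin n → Disk} (hgen : GeneralPosition D) {S : Set (Fin n)}
    (hI : Independent D S) {a b c : Fin n} (ha : a ∈ S) (hb : b ∈ S) (hc : c ∈ S) (hab : a ≠ b)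
    (hac : a ≠ c) (hbc : b ≠ c) {p q r : Plane} (hp : p ∈ contact D S a) (hq : q ∈ contact D S b)
    (hr : r ∈ contact D S c) : orient p q r ≠ 0 := by
  intro h
  have hp' := contact_subset_carrier _ _ _ hp
  have hq' := contact_subset_carrier _ _ _ hq
  have hr' := contact_subset_carrier _ _ _ hr
  rcases wbtw_of_orient_eq_zero h with h | h | h
  · exact not_wbtw_contact hgen hI ha hb hc hab hac hbc hp' hq hr' h
  · exact not_wbtw_contact hgen hI hb hc ha hbc hab.symm hac.symm hq' hr hp' h
  · exact not_wbtw_contact hgen hI hc ha hb hac.symm hbc.symm hab hr' hp hq' h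

/-- All triples of points on the arcs of three disks in strongly convex position have the same
orientation. -/
theorem orient_contact_pos {D : Fin n → Disk} (hgen : GeneralPosition D) {S : Set (Fin n)}
    (hS : StronglyConvex D S) (hI : Independent D S) {a b c : Fin n} (ha : a ∈ S) (hb : b ∈ S)
    (hc : c ∈ S) (hab : a ≠ b) (hac : a ≠ c) (hbc : b ≠ c) {p q r p' q' r' : Plane}
    (hp : p ∈ contact D S a) (hq : q ∈ contact D S b) (hr : r ∈ contact D S c)
    (hp' : p' ∈ contact D S a) (hq' : q' ∈ contact D S b) (hr' : r' ∈ contact D S c)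
    (h : 0 < orient p q r) : 0 < orient p' q' r' := by
  by_contra! hle
  -- The orientation is continuous and never zero on the connected product of the three arcs.
  have hconn := ((hS a ha).2.prod ((hS b hb).2.prod (hS c hc).2)).isPreconnected
  have hcont : Continuous fun z : Plane × Plane × Plane => orient z.1 z.2.1 z.2.2 :=
    continuous_cross (by fun_prop) (by fun_prop)
  obtain ⟨⟨x, y, z⟩, ⟨hx, hy, hz⟩, h0⟩ := hconn.intermediate_value
    (a := (p', q', r')) (b := (p, q, r)) ⟨hp', hq', hr'⟩ ⟨hp, hq, hr⟩ hcont.continuousOn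
    ⟨hle, h.le⟩
  exact orient_contact_ne_zero hgen hI ha hb hc hab hac hbc hx hy hz h0

theorem orient_rotate (a b c : Plane) : orient b c a = orient a b c := by
  simp only [orient, cross, PiLp.sub_apply]
  ring

/-- A functional separating the centroid from the interior would take its maximum over the three
disks at all three points, giving a common tangent line. -/
theorem centroid_mem_interior_hull {D : Fin n → Disk} (hgen : GeneralPosition D)
    {S : Set (Fin n)} {a b c : Fin n} (ha : a ∈ S) (hb : b ∈ S) (hc : c ∈ S) (hab : a ≠ b)
    (hac : a ≠ c) (hbc : b ≠ c) {p q r : Plane} (hp : p ∈ (D a).carrier) (hq : q ∈ (D b).carrier)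
    (hr : r ∈ (D c).carrier) : (3⁻¹ : ℝ) • (p + q + r) ∈ interior (hull D S) := by
  by_contra h
  obtain ⟨x, hx, hxl⟩ := exists_normal_of_notMem_interior ⟨a, ha⟩ h
  have ea := hxl a ha
  have eb := hxl b hb
  have ec := hxl c hc
  rw [inner_smul_right, inner_add_right, inner_add_right] at ea eb ec
  have e1 := inner_le_supp hx hp
  have e2 := inner_le_supp hx hq
  have e3 := inner_le_supp hx hr
  exact hgen.not_supp_eq hab hac hbc hx (t := (D b).supp x) (by linarith) rfl (by linarith)

theorem cross_smul_unitVec (s t α β : ℝ) :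
    cross (s • unitVec α) (t • unitVec β) = s * t * Real.sin (β - α) := by
  rw [Real.sin_sub]
  simp only [cross, unitVec, PiLp.smul_apply, smul_eq_mul, Matrix.cons_val_zero,
    Matrix.cons_val_one]
  ring

/-- Seen from the centroid, consecutive points span cross products equal to a third of the
orientation. If this were not positive, two consecutive angular gaps would each be at least $\pi$,
exceeding the allowed turn. -/
theorem orient_pos_of_lt {D : Fin n → Disk} (hgen : GeneralPosition D)
    (hccw : CounterclockwiseIndexed D) {q : Fin n → Plane} (hq : ∀ i, q i ∈ contact D univ i)
    {a b c : Fin n} (hab : a < b) (hbc : b < c) : 0 < orient (q a) (q b) (q c) := by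
  by_contra! hle
  have hcar : ∀ i, q i ∈ (D i).carrier := fun i => contact_subset_carrier _ _ _ (hq i)
  obtain ⟨t, hmono, hspan, hpt⟩ := hccw _ (centroid_mem_interior_hull hgen (mem_univ a)
    (mem_univ b) (mem_univ c) hab.ne (hab.trans hbc).ne hbc.ne (hcar a) (hcar b) (hcar c)) q hq
  set o : Plane := (3⁻¹ : ℝ) • (q a + q b + q c) with ho
  obtain ⟨sa, hsa, ea⟩ := hpt a
  obtain ⟨sb, hsb, eb⟩ := hpt b
  obtain ⟨sc, hsc, ec⟩ := hpt c
  have h1 : cross (q a - o) (q b - o) = orient (q a) (q b) (q c) / 3 := by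
    simp only [ho, orient, cross, PiLp.sub_apply, PiLp.smul_apply, PiLp.add_apply, smul_eq_mul]
    ring
  have h2 : cross (q b - o) (q c - o) = orient (q a) (q b) (q c) / 3 := by
    simp only [ho, orient, cross, PiLp.sub_apply, PiLp.smul_apply, PiLp.add_apply, smul_eq_mul]
    ring
  have key : ∀ s s' α β : ℝ, 0 < s → 0 < s' → α < β → s * s' * Real.sin (β - α) ≤ 0 →
      Real.pi ≤ β - α := by
    intro s s' α β hs hs' hαβ hneg
    by_contra! hlt
    exact absurd hneg (not_le.2 (mul_pos (mul_pos hs hs')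
      (Real.sin_pos_of_pos_of_lt_pi (sub_pos.2 hαβ) hlt)))
  rw [sub_eq_of_eq_add' ea, sub_eq_of_eq_add' eb, cross_smul_unitVec] at h1
  rw [sub_eq_of_eq_add' eb, sub_eq_of_eq_add' ec, cross_smul_unitVec] at h2
  have k1 := key _ _ _ _ hsa hsb (hmono hab) (by linarith)
  have k2 := key _ _ _ _ hsb hsc (hmono hbc) (by linarith)
  linarith [hspan a c]

theorem orient_pos_of_between {D : Fin n → Disk} (hgen : GeneralPosition D)
    (hccw : CounterclockwiseIndexed D) {q : Fin n → Plane} (hq : ∀ i, q i ∈ contact D univ i)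
    {i j h : Fin n} (hh : h ∈ between i j) : 0 < orient (q i) (q h) (q j) := by
  rcases hh with ⟨-, h1, h2⟩ | ⟨h1, h2 | h2⟩
  · exact orient_pos_of_lt hgen hccw hq h1 h2
  · rw [← orient_rotate, ← orient_rotate]
    exact orient_pos_of_lt hgen hccw hq h1 h2
  · rw [← orient_rotate]
    exact orient_pos_of_lt hgen hccw hq h2 h1

/-- A disk between `i` and `j` in strongly convex position with these lies below their upper outer
common tangent. -/
theorem supp_lt_of_between {D : Fin n → Disk} (hconv : StronglyConvex D univ)
    (hgen : GeneralPosition D) (hccw : CounterclockwiseIndexed D) {i j h : Fin n}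
    (hh : h ∈ between i j) (hij : i ≠ j) (hih : i ≠ h) (hjh : j ≠ h)
    (hS : StronglyConvex D {h, i, j}) (hI : Independent D {h, i, j}) {u w : Plane}
    (hu : OuterNormal (D i) (D j) u) (hw : OuterNormal (D i) (D j) w)
    (hcu : 0 < cross ((D j).center - (D i).center) u)
    (hcw : cross ((D j).center - (D i).center) w < 0) : (D h).supp u < (D i).supp u := by
  by_contra! hle
  have hi : i ∈ ({h, i, j} : Set (Fin n)) := by simp
  have hj : j ∈ ({h, i, j} : Set (Fin n)) := by simp
  have hm : h ∈ ({h, i, j} : Set (Fin n)) := by simp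
  have hsub : ({h, i, j} : Set (Fin n)) ⊆ {i, j, h} := by
    rintro l (rfl | rfl | rfl) <;> simp
  -- A disk reaching the upper tangent stays off the lower one, so `i` and `j` have contact points
  -- on the lower tangent and `h` has one strictly above it. This triple is clockwise, against the
  -- index order.
  have hlt : (D h).supp w < (D i).supp w := by
    by_contra! hge
    exact not_both_tangents_crossed hS hI hsub hi hj hm hij hih hjh hu hw hcu hcw ⟨hle, hge⟩
  have hci : (D i).center + (D i).radius • w ∈ contact D {h, i, j} i := by
    rw [contact_eq_image D hi]
    refine ⟨w, ⟨hw.1, ?_⟩, rfl⟩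
    rintro l (rfl | rfl | rfl)
    exacts [hlt.le, le_rfl, hw.2.ge]
  have hcj : (D j).center + (D j).radius • w ∈ contact D {h, i, j} j := by
    rw [contact_eq_image D hj]
    refine ⟨w, ⟨hw.1, ?_⟩, rfl⟩
    rintro l (rfl | rfl | rfl)
    exacts [hw.2 ▸ hlt.le, hw.2.le, le_rfl]
  have hch : (D h).center + (D h).radius • u ∈ contact D {h, i, j} h := by
    rw [contact_eq_image D hm]
    refine ⟨u, ⟨hu.1, ?_⟩, rfl⟩
    rintro l (rfl | rfl | rfl)
    exacts [le_rfl, hle, hu.2 ▸ hle]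
  choose q hq using fun l => (hconv l (mem_univ l)).1.nonempty
  have hpos := orient_contact_pos hgen hS hI hi hm hj hih hij hjh.symm
    (contact_anti D (subset_univ _) hi (hq i)) (contact_anti D (subset_univ _) hm (hq h))
    (contact_anti D (subset_univ _) hj (hq j)) hci hch hcj
    (orient_pos_of_between hgen hccw hq hh)
  set a := (D i).center + (D i).radius • w with ha
  set b := (D h).center + (D h).radius • u with hb
  set c := (D j).center + (D j).radius • w with hc
  have h1 := norm_sq_mul_cross w (b - a) (c - a)
  have h2 : inner ℝ w (c - a) = 0 := by
    rw [inner_sub_right, ha, hc, inner_boundary hw.1, inner_boundary hw.1, hw.2, sub_self]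
  have h3 : cross w (c - a) = - cross ((D j).center - (D i).center) w := by
    simp only [ha, hc, cross, PiLp.sub_apply, PiLp.add_apply, PiLp.smul_apply, smul_eq_mul]
    ring
  have h4 : inner ℝ w (b - a) < 0 := by
    rw [inner_sub_right, ha, inner_boundary hw.1]
    have := inner_le_supp hw.1 (circle_subset_carrier _ (boundary_mem_circle (A := D h) hu.1))
    linarith
  rw [h2, h3, hw.1] at h1
  rw [orient] at hpos
  nlinarith [mul_pos (neg_pos.2 hcw) (neg_pos.2 h4)]

/-! ### The bisector as a branch of a hyperbola. -/

namespace Disk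

/-- Half the distance of the centers. -/
def halfDist (A B : Disk) : ℝ := dist A.center B.center / 2

/-- Half the difference of the radii. -/
def halfDiff (A B : Disk) : ℝ := (A.radius - B.radius) / 2

/-- The unit vector pointing from the first center to the second one. -/
def axis (A B : Disk) : Plane := (dist A.center B.center)⁻¹ • (B.center - A.center)

/-- The semi-minor axis of the hyperbola containing the bisector. -/
def minorAxis (A B : Disk) : ℝ := Real.sqrt (A.halfDist B ^ 2 - A.halfDiff B ^ 2)

/-- A parametrization of the bisector of two disks, where `b` is up to sign the semi-minor axis of
the hyperbola containing it. -/
def bisectorCurve (A B : Disk) (b t : ℝ) : Plane :=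
  A.center + frame (A.axis B) (A.halfDist B + A.halfDiff B * Real.cosh t) (b * Real.sinh t)

/-- The normals of the outer common tangents, where `b` is up to sign the semi-minor axis. -/
def tangentNormal (A B : Disk) (b : ℝ) : Plane :=
  frame (A.axis B) (A.halfDiff B / A.halfDist B) (b / A.halfDist B)

variable {A B : Disk}

theorem Disj.halfDist_pos (h : A.Disj B) : 0 < A.halfDist B :=
  half_pos (dist_pos.2 h.center_ne)

theorem Disj.norm_axis (h : A.Disj B) : ‖A.axis B‖ = 1 := by
  rw [axis, norm_smul, norm_inv, dist_comm, dist_eq_norm, norm_norm]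
  exact inv_mul_cancel₀ (norm_ne_zero_iff.2 (sub_ne_zero.2 h.center_ne.symm))

theorem Disj.center_sub (h : A.Disj B) :
    B.center - A.center = (2 * A.halfDist B) • A.axis B := by
  rw [axis, halfDist, mul_div_cancel₀ _ two_ne_zero, smul_smul,
    mul_inv_cancel₀ (dist_pos.2 h.center_ne).ne', one_smul]

theorem Disj.halfDiff_sq_lt (h : A.Disj B) : A.halfDiff B ^ 2 < A.halfDist B ^ 2 := by
  apply sq_lt_sq'
  · unfold halfDiff halfDist Disj at *
    linarith [A.radius_pos]
  · unfold halfDiff halfDist Disj at *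
    linarith [B.radius_pos]

theorem Disj.minorAxis_pos (h : A.Disj B) : 0 < A.minorAxis B :=
  Real.sqrt_pos.2 (sub_pos.2 h.halfDiff_sq_lt)

theorem Disj.minorAxis_sq (h : A.Disj B) :
    A.minorAxis B ^ 2 = A.halfDist B ^ 2 - A.halfDiff B ^ 2 :=
  Real.sq_sqrt (sub_pos.2 h.halfDiff_sq_lt).le

theorem Disj.abs_halfDiff_le (h : A.Disj B) (t : ℝ) :
    |A.halfDiff B| ≤ A.halfDist B * Real.cosh t := by
  have h1 := abs_le_of_sq_le_sq h.halfDiff_sq_lt.le h.halfDist_pos.le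
  have h2 := le_mul_of_one_le_right h.halfDist_pos.le (Real.one_le_cosh t)
  exact h1.trans h2

/-- The sign of `halfDiff` selects the branch of the hyperbola with the centers as foci; for equal
radii the curve is the perpendicular bisector. -/
theorem Disj.dist_left_bisectorCurve (h : A.Disj B) {b : ℝ}
    (hb : b ^ 2 = A.halfDist B ^ 2 - A.halfDiff B ^ 2) (t : ℝ) :
    dist A.center (A.bisectorCurve B b t) = A.halfDist B * Real.cosh t + A.halfDiff B := by
  have h1 := (abs_le.1 (h.abs_halfDiff_le t)).1
  rw [← sq_eq_sq₀ dist_nonneg (by linarith), dist_comm, dist_eq_norm, bisectorCurve,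
    add_sub_cancel_left, norm_sq_frame h.norm_axis]
  linear_combination Real.sinh t ^ 2 * hb - (A.halfDist B ^ 2 - A.halfDiff B ^ 2) * Real.cosh_sq t

theorem Disj.bisectorCurve_sub_right (h : A.Disj B) (b t : ℝ) :
    A.bisectorCurve B b t - B.center =
      frame (A.axis B) (A.halfDiff B * Real.cosh t - A.halfDist B) (b * Real.sinh t) := by
  rw [bisectorCurve, show B.center = A.center + (B.center - A.center) by abel, h.center_sub]
  apply plane_ext
  · simp only [PiLp.sub_apply, PiLp.add_apply, PiLp.smul_apply, frame_zero, smul_eq_mul]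
    ring
  · simp only [PiLp.sub_apply, PiLp.add_apply, PiLp.smul_apply, frame_one, smul_eq_mul]
    ring

theorem Disj.dist_right_bisectorCurve (h : A.Disj B) {b : ℝ}
    (hb : b ^ 2 = A.halfDist B ^ 2 - A.halfDiff B ^ 2) (t : ℝ) :
    dist B.center (A.bisectorCurve B b t) = A.halfDist B * Real.cosh t - A.halfDiff B := by
  have h1 := (abs_le.1 (h.abs_halfDiff_le t)).2
  rw [← sq_eq_sq₀ dist_nonneg (by linarith), dist_comm, dist_eq_norm, h.bisectorCurve_sub_right,
    norm_sq_frame h.norm_axis]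
  linear_combination Real.sinh t ^ 2 * hb - (A.halfDist B ^ 2 - A.halfDiff B ^ 2) * Real.cosh_sq t

theorem Disj.wdist_bisectorCurve (h : A.Disj B) {b : ℝ}
    (hb : b ^ 2 = A.halfDist B ^ 2 - A.halfDiff B ^ 2) (t : ℝ) :
    A.wdist (A.bisectorCurve B b t) = B.wdist (A.bisectorCurve B b t) := by
  rw [wdist, wdist, h.dist_left_bisectorCurve hb, h.dist_right_bisectorCurve hb, halfDiff]
  ring

theorem Disj.cross_bisectorCurve (h : A.Disj B) (b t : ℝ) :
    cross (B.center - A.center) (A.bisectorCurve B b t) =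
      cross (B.center - A.center) A.center + 2 * A.halfDist B * b * Real.sinh t := by
  have h1 := cross_frame h.norm_axis (A.halfDist B + A.halfDiff B * Real.cosh t) (b * Real.sinh t)
  rw [h.center_sub, bisectorCurve]
  simp only [cross, PiLp.add_apply, PiLp.smul_apply, smul_eq_mul] at h1 ⊢
  linear_combination 2 * A.halfDist B * h1

theorem Disj.exists_eq_bisectorCurve (h : A.Disj B) {q : Plane} (hq : A.wdist q = B.wdist q) :
    ∃ t, q = A.bisectorCurve B (A.minorAxis B) t := by
  set a := A.halfDist B with ha
  set α := A.halfDiff B with hα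
  set b := A.minorAxis B with hb
  have hb2 : b ^ 2 = a ^ 2 - α ^ 2 := h.minorAxis_sq
  have hbpos : 0 < b := h.minorAxis_pos
  have hapos : 0 < a := h.halfDist_pos
  set x := inner ℝ (A.axis B) (q - A.center) with hx
  set y := cross (A.axis B) (q - A.center) with hy
  have hqf : q = A.center + frame (A.axis B) x y := by
    rw [frame_inner_cross h.norm_axis]
    abel
  have hA : dist A.center q ^ 2 = x ^ 2 + y ^ 2 := by
    rw [dist_comm, dist_eq_norm, ← inner_sq_add_cross_sq h.norm_axis]
  have hqB : q - B.center = frame (A.axis B) (x - 2 * a) y := by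
    rw [show B.center = A.center + (B.center - A.center) by abel, h.center_sub]
    nth_rewrite 1 [hqf]
    apply plane_ext
    · simp only [PiLp.sub_apply, PiLp.add_apply, PiLp.smul_apply, frame_zero, smul_eq_mul]
      ring
    · simp only [PiLp.sub_apply, PiLp.add_apply, PiLp.smul_apply, frame_one, smul_eq_mul]
      ring
  have hB : dist B.center q ^ 2 = (x - 2 * a) ^ 2 + y ^ 2 := by
    rw [dist_comm, dist_eq_norm, hqB, norm_sq_frame h.norm_axis]
  set s := (dist A.center q + dist B.center q) / 2 with hs
  have hdiff : dist A.center q - dist B.center q = 2 * α := by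
    unfold wdist at hq
    rw [hα, halfDiff]
    linarith
  have hA' : dist A.center q = s + α := by linarith
  have hB' : dist B.center q = s - α := by linarith
  have hs0 : 0 ≤ s := by positivity
  rw [hA'] at hA
  rw [hB'] at hB
  have hxs : a * (x - a) = s * α := by linear_combination (hB - hA) / 4
  -- The parameter is read off from the coordinate across the axis. The sum of the distances to the
  -- centers then fixes the other coordinate.
  set t := Real.arsinh (y / b) with ht
  have hsinh : b * Real.sinh t = y := by
    rw [ht, Real.sinh_arsinh]
    field_simp
  have hsq : s ^ 2 = (a * Real.cosh t) ^ 2 := by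
    have hb2' : b ^ 2 ≠ 0 := by positivity
    apply mul_left_cancel₀ hb2'
    have h1 : b ^ 2 * Real.cosh t ^ 2 = b ^ 2 + y ^ 2 := by
      rw [Real.cosh_sq, ← hsinh]
      ring
    have h2 : s ^ 2 + α ^ 2 = (x - a) ^ 2 + a ^ 2 + y ^ 2 := by linear_combination (hA + hB) / 2
    linear_combination s ^ 2 * hb2 - a ^ 2 * h1 + a ^ 2 * h2 +
      (a * (x - a) + s * α) * hxs - a ^ 2 * hb2
  have hcosh : s = a * Real.cosh t :=
    (sq_eq_sq₀ hs0 (mul_nonneg hapos.le (Real.cosh_pos t).le)).1 hsq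
  refine ⟨t, ?_⟩
  rw [bisectorCurve, ← ha, ← hα, hsinh]
  have hxx : x = a + α * Real.cosh t := by
    apply mul_left_cancel₀ hapos.ne'
    rw [hcosh] at hxs
    linear_combination hxs
  rw [← hxx]
  exact hqf

theorem continuous_bisectorCurve (A B : Disk) (b : ℝ) : Continuous (A.bisectorCurve B b) := by
  unfold bisectorCurve frame
  refine continuous_const.add ((PiLp.continuous_toLp 2 _).comp ?_)
  refine continuous_pi fun k => ?_
  fin_cases k
  · simp only [Fin.zero_eta, Matrix.cons_val_zero]
    fun_prop
  · simp only [Fin.mk_one, Matrix.cons_val_one]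
    fun_prop

/-- Reversing the parameter amounts to changing the sign of `b`, so limits at the lower end follow
from those at the upper end. -/
theorem bisectorCurve_neg (A B : Disk) (b t : ℝ) :
    A.bisectorCurve B b (-t) = A.bisectorCurve B (-b) t := by
  simp [bisectorCurve]

theorem Disj.outerNormal_tangentNormal (h : A.Disj B) {b : ℝ}
    (hb : b ^ 2 = A.halfDist B ^ 2 - A.halfDiff B ^ 2) : OuterNormal A B (A.tangentNormal B b) := by
  have ha := h.halfDist_pos
  constructor
  · rw [← pow_eq_one_iff_of_nonneg (norm_nonneg _) two_ne_zero, tangentNormal,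
      norm_sq_frame h.norm_axis]
    field_simp
    linarith
  · have h1 : inner ℝ (A.tangentNormal B b) (B.center - A.center) = 2 * A.halfDiff B := by
      rw [h.center_sub, inner_smul_right, tangentNormal, real_inner_comm, inner_frame h.norm_axis]
      field_simp
    rw [inner_sub_right, halfDiff] at h1
    unfold supp
    linarith

theorem Disj.cross_tangentNormal (h : A.Disj B) (b : ℝ) :
    cross (B.center - A.center) (A.tangentNormal B b) = 2 * b := by
  have ha := h.halfDist_pos
  have h1 := cross_frame h.norm_axis (A.halfDiff B / A.halfDist B) (b / A.halfDist B)
  rw [h.center_sub, tangentNormal]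
  simp only [cross, PiLp.smul_apply, smul_eq_mul] at h1 ⊢
  have h2 : 2 * A.halfDist B * (b / A.halfDist B) = 2 * b := by field_simp
  linear_combination 2 * A.halfDist B * h1 + h2

end Disk

/-! ### Behavior at the ends of the bisector. -/

/-- The difference of the distances to two points tends to a difference of linear functionals along
a curve that leaves to infinity in a given direction. -/
theorem tendsto_dist_sub_dist {γ : ℝ → Plane} {ε : ℝ → ℝ} {ξ : Plane} {l : Filter ℝ}
    (hpos : ∀ t, 0 < ε t) (hε : Tendsto ε l (𝓝 0)) (hγ : Tendsto (fun t => ε t • γ t) l (𝓝 ξ))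
    (hξ : ξ ≠ 0) (p q : Plane) :
    Tendsto (fun t => dist p (γ t) - dist q (γ t)) l (𝓝 (inner ℝ ξ (q - p) / ‖ξ‖)) := by
  have hp : ∀ p : Plane, Tendsto (fun t => ε t • γ t - ε t • p) l (𝓝 ξ) := by
    intro p
    simpa using hγ.sub (hε.smul_const p)
  -- The difference of distances is rationalized: the difference of squares over the sum, both
  -- scaled by `ε`.
  have hnum : Tendsto (fun t => inner ℝ ((ε t • γ t - ε t • p) + (ε t • γ t - ε t • q)) (q - p)) l
      (𝓝 (inner ℝ (ξ + ξ) (q - p))) := ((hp p).add (hp q)).inner tendsto_const_nhds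
  have hden : Tendsto (fun t => ‖ε t • γ t - ε t • p‖ + ‖ε t • γ t - ε t • q‖) l
      (𝓝 (‖ξ‖ + ‖ξ‖)) := (hp p).norm.add (hp q).norm
  have hξn : ‖ξ‖ ≠ 0 := norm_ne_zero_iff.2 hξ
  have hne : ‖ξ‖ + ‖ξ‖ ≠ 0 := by
    rw [← two_mul]
    exact mul_ne_zero two_ne_zero hξn
  have hlim := hnum.div hden hne
  have hval : inner ℝ (ξ + ξ) (q - p) / (‖ξ‖ + ‖ξ‖) = inner ℝ ξ (q - p) / ‖ξ‖ := by
    rw [inner_add_left]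
    field_simp
  rw [hval] at hlim
  refine hlim.congr' ?_
  filter_upwards [hden.eventually_ne hne] with t ht
  have h1 : ∀ p : Plane, ‖ε t • γ t - ε t • p‖ = ε t * dist p (γ t) := by
    intro p
    rw [← smul_sub, norm_smul, Real.norm_of_nonneg (hpos t).le, dist_comm, dist_eq_norm]
  have h2 : ∀ p : Plane, dist p (γ t) ^ 2 = ‖γ t - p‖ ^ 2 := by
    intro p
    rw [dist_comm, dist_eq_norm]
  simp only [Pi.div_apply]
  rw [div_eq_iff ht, h1, h1]
  have h3 : ε t • γ t - ε t • p + (ε t • γ t - ε t • q) = ε t • ((γ t - p) + (γ t - q)) := by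
    module
  have h4 : inner ℝ ((γ t - p) + (γ t - q)) (q - p) = ‖γ t - p‖ ^ 2 - ‖γ t - q‖ ^ 2 := by
    simp only [norm_sq_eq_coords, inner_eq_coords, PiLp.sub_apply, PiLp.add_apply]
    ring
  rw [h3, real_inner_smul_left, h4]
  linear_combination ε t * (h2 q - h2 p)

namespace Disk

variable {A B : Disk}

/-- The asymptotic direction of the hyperbola is the normal of the outer common tangent, so distance
differences become differences of support functions there. -/
theorem Disj.tendsto_wdist_sub_wdist (h : A.Disj B) {b : ℝ}
    (hb : b ^ 2 = A.halfDist B ^ 2 - A.halfDiff B ^ 2) (C : Disk) :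
    Tendsto (fun t => C.wdist (A.bisectorCurve B b t) - A.wdist (A.bisectorCurve B b t)) atTop
      (𝓝 (A.supp (A.tangentNormal B b) - C.supp (A.tangentNormal B b))) := by
  have ha := h.halfDist_pos
  set u := A.tangentNormal B b with hu
  have hun : ‖u‖ = 1 := (h.outerNormal_tangentNormal hb).1
  have hε : Tendsto (fun t : ℝ => Real.exp (-t)) atTop (𝓝 0) := Real.tendsto_exp_neg_atTop_nhds_zero
  have hγ : Tendsto (fun t => Real.exp (-t) • A.bisectorCurve B b t) atTop
      (𝓝 ((A.halfDist B / 2) • u)) := by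
    have heq : ∀ t, Real.exp (-t) • A.bisectorCurve B b t =
        Real.exp (-t) • (A.center + A.halfDist B • A.axis B) + (A.halfDist B / 2) • u +
          (Real.exp (-t)) ^ 2 • ((A.halfDist B / 2) • A.tangentNormal B (-b)) := by
      intro t
      have he : Real.exp (-t) * Real.exp t = 1 := by rw [← Real.exp_add]; simp
      have hc : Real.exp (-t) * Real.cosh t = (1 + Real.exp (-t) ^ 2) / 2 := by
        rw [Real.cosh_eq]
        linear_combination he / 2
      have hs : Real.exp (-t) * Real.sinh t = (1 - Real.exp (-t) ^ 2) / 2 := by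
        rw [Real.sinh_eq]
        linear_combination he / 2
      have e1 : A.halfDist B * (A.halfDiff B / A.halfDist B) = A.halfDiff B := by field_simp
      have e2 : A.halfDist B * (b / A.halfDist B) = b := by field_simp
      rw [hu, tangentNormal, tangentNormal, bisectorCurve, neg_div]
      generalize A.halfDiff B / A.halfDist B = r at *
      generalize b / A.halfDist B = r' at *
      rw [← e1, ← e2]
      apply plane_ext
      · simp only [PiLp.add_apply, PiLp.smul_apply, frame_zero, smul_eq_mul]
        linear_combination A.halfDist B * r * A.axis B 0 * hc - A.halfDist B * r' * A.axis B 1 * hs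
      · simp only [PiLp.add_apply, PiLp.smul_apply, frame_one, smul_eq_mul]
        linear_combination A.halfDist B * r * A.axis B 1 * hc + A.halfDist B * r' * A.axis B 0 * hs
    simp only [heq]
    simpa using ((hε.smul_const (A.center + A.halfDist B • A.axis B)).add_const
      ((A.halfDist B / 2) • u)).add
        ((hε.pow 2).smul_const ((A.halfDist B / 2) • A.tangentNormal B (-b)))
  have hξ : (A.halfDist B / 2) • u ≠ 0 := by
    refine smul_ne_zero (half_pos ha).ne' ?_
    rintro h0
    rw [h0] at hun
    simp at hun
  have hlim := (tendsto_dist_sub_dist (fun t => Real.exp_pos (-t)) hε hγ hξ C.center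
    A.center).add_const (A.radius - C.radius)
  have hval : inner ℝ ((A.halfDist B / 2) • u) (A.center - C.center) / ‖(A.halfDist B / 2) • u‖ +
      (A.radius - C.radius) = A.supp u - C.supp u := by
    rw [norm_smul, hun, Real.norm_of_nonneg (half_pos ha).le, real_inner_smul_left,
      inner_sub_right, supp, supp]
    field_simp
    ring
  rw [hval] at hlim
  refine hlim.congr fun t => ?_
  unfold wdist
  ring

end Disk

/-! ### Existence of the vertex and monotonicity along the bisector. -/

theorem ne_of_mem_between {i j h : Fin n} (hh : h ∈ between i j) : i ≠ j ∧ i ≠ h ∧ j ≠ h := by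
  simp only [between, mem_ofPred_eq] at hh
  refine ⟨?_, ?_, ?_⟩ <;> rintro rfl <;> omega

theorem ne_of_mem_between_of_mem_between {i j h k : Fin n} (hh : h ∈ between i j)
    (hk : k ∈ between j i) : h ≠ k := by
  rintro rfl
  simp only [between, mem_ofPred_eq] at hh hk
  omega

theorem Disk.Disj.wdist_pos {A B : Disk} (h : A.Disj B) {q : Plane} (hq : A.wdist q = B.wdist q) :
    0 < A.wdist q := by
  have := dist_triangle_right A.center B.center q
  unfold wdist at *
  unfold Disj at h
  linarith

theorem Disk.Disj.tendsto_atBot {A B : Disk} (h : A.Disj B) (C : Disk) :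
    Tendsto (fun t => C.wdist (A.bisectorCurve B (A.minorAxis B) t) -
      A.wdist (A.bisectorCurve B (A.minorAxis B) t)) atBot
      (𝓝 (A.supp (A.tangentNormal B (-A.minorAxis B)) -
        C.supp (A.tangentNormal B (-A.minorAxis B)))) := by
  have hb : (-A.minorAxis B) ^ 2 = A.halfDist B ^ 2 - A.halfDiff B ^ 2 := by
    rw [neg_sq, h.minorAxis_sq]
  refine ((h.tendsto_wdist_sub_wdist hb C).comp tendsto_neg_atBot_atTop).congr fun t => ?_
  simp only [Function.comp, bisectorCurve_neg, neg_neg]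

theorem Disk.continuous_wdist_bisectorCurve (A B C : Disk) (b : ℝ) :
    Continuous fun t => C.wdist (A.bisectorCurve B b t) := by
  unfold wdist
  exact (continuous_const.dist (continuous_bisectorCurve A B b)).sub continuous_const

/-- Exactly one outer tangent is crossed by the third disk, so the distance difference has opposite
strict signs near the two ends of the bisector. -/
theorem exists_equidistant {D : Fin n → Disk} {i j k : Fin n} (hij : i ≠ j) (hik : i ≠ k)
    (hjk : j ≠ k) (hS : StronglyConvex D {i, j, k}) (hI : Independent D {i, j, k}) :
    ∃ v, Equidistant D i j k v := by
  have hi : i ∈ ({i, j, k} : Set (Fin n)) := by simp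
  have hj : j ∈ ({i, j, k} : Set (Fin n)) := by simp
  have hk : k ∈ ({i, j, k} : Set (Fin n)) := by simp
  have hd : (D i).Disj (D j) := hI i hi j hj hij
  set b := (D i).minorAxis (D j) with hb
  have hbpos : 0 < b := hd.minorAxis_pos
  have hb2 : b ^ 2 = (D i).halfDist (D j) ^ 2 - (D i).halfDiff (D j) ^ 2 := hd.minorAxis_sq
  have hu := hd.outerNormal_tangentNormal hb2
  have hw := hd.outerNormal_tangentNormal (b := -b) (by rw [neg_sq, hb2])
  have hcu : 0 < cross ((D j).center - (D i).center) ((D i).tangentNormal (D j) b) := by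
    rw [hd.cross_tangentNormal]
    linarith
  have hcw : cross ((D j).center - (D i).center) ((D i).tangentNormal (D j) (-b)) < 0 := by
    rw [hd.cross_tangentNormal]
    linarith
  have h1 := not_both_tangents_crossed hS hI Subset.rfl hi hj hk hij hik hjk hu hw hcu hcw
  have h2 := some_tangent_crossed hS hI Subset.rfl hi hj hk hij hik hjk hu hw hcu hcw
  have htop := hd.tendsto_wdist_sub_wdist hb2 (D k)
  have hbot := hd.tendsto_atBot (D k)
  have hcont : Continuous fun t => (D k).wdist ((D i).bisectorCurve (D j) b t) -
      (D i).wdist ((D i).bisectorCurve (D j) b t) :=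
    (continuous_wdist_bisectorCurve _ _ _ _).sub (continuous_wdist_bisectorCurve _ _ _ _)
  have hzero : ∃ t, (D k).wdist ((D i).bisectorCurve (D j) b t) -
      (D i).wdist ((D i).bisectorCurve (D j) b t) = 0 := by
    rcases le_or_gt ((D i).supp ((D i).tangentNormal (D j) b))
      ((D k).supp ((D i).tangentNormal (D j) b)) with h | h
    · have hw' : (D k).supp ((D i).tangentNormal (D j) (-b)) <
          (D i).supp ((D i).tangentNormal (D j) (-b)) := by
        by_contra! hle
        exact h1 ⟨h, hle⟩
      have hu' : (D i).supp ((D i).tangentNormal (D j) b) <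
          (D k).supp ((D i).tangentNormal (D j) b) := by
        by_contra! hle
        exact h2 ⟨hle, hw'.le⟩
      obtain ⟨s, hs⟩ := (htop.eventually_lt_const (sub_neg.2 hu')).exists
      obtain ⟨t, ht⟩ := (hbot.eventually_const_lt (sub_pos.2 hw')).exists
      exact mem_range_of_exists_le_of_exists_ge hcont ⟨s, hs.le⟩ ⟨t, ht.le⟩
    · have hw' : (D i).supp ((D i).tangentNormal (D j) (-b)) <
          (D k).supp ((D i).tangentNormal (D j) (-b)) := by
        by_contra! hle
        exact h2 ⟨h.le, hle⟩
      obtain ⟨s, hs⟩ := (htop.eventually_const_lt (sub_pos.2 h)).exists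
      obtain ⟨t, ht⟩ := (hbot.eventually_lt_const (sub_neg.2 hw')).exists
      exact mem_range_of_exists_le_of_exists_ge hcont ⟨t, ht.le⟩ ⟨s, hs.le⟩
  obtain ⟨t, ht⟩ := hzero
  exact ⟨_, hd.wdist_bisectorCurve hb2 t, (sub_eq_zero.1 ht).symm⟩

/-- A disk between `i` and `j` whose distance at a point of the bisector exceeds that of the disk
`i` does not have a smaller distance at a higher point of the bisector. -/
theorem not_wdist_lt_of_prec {D : Fin n → Disk} (hgen : GeneralPosition D) {i j h : Fin n}
    (hij : i ≠ j) (hih : i ≠ h) (hjh : j ≠ h)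
    (hS : StronglyConvex D {h, i, j}) (hI : Independent D {h, i, j})
    (hlow : (D h).supp ((D i).tangentNormal (D j) ((D i).minorAxis (D j))) <
      (D i).supp ((D i).tangentNormal (D j) ((D i).minorAxis (D j))))
    {v v' : Plane} (hprec : PrecPoint D i j v v') (hv : (D i).wdist v < (D h).wdist v) :
    ¬ (D h).wdist v' < (D i).wdist v' := by
  intro hv'
  have hd : (D i).Disj (D j) := hI i (by simp) j (by simp) hij
  obtain ⟨hvb, hvb', hlt⟩ := hprec
  obtain ⟨s, rfl⟩ := hd.exists_eq_bisectorCurve hvb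
  obtain ⟨s', rfl⟩ := hd.exists_eq_bisectorCurve hvb'
  set b := (D i).minorAxis (D j) with hb
  have hbpos : 0 < b := hd.minorAxis_pos
  have hb2 : b ^ 2 = (D i).halfDist (D j) ^ 2 - (D i).halfDiff (D j) ^ 2 := hd.minorAxis_sq
  have hab : 0 < 2 * (D i).halfDist (D j) * b := by
    have := hd.halfDist_pos
    positivity
  rw [hd.cross_bisectorCurve, hd.cross_bisectorCurve, add_lt_add_iff_left,
    mul_lt_mul_iff_right₀ hab, Real.sinh_lt_sinh] at hlt
  set F : ℝ → ℝ := fun t => (D h).wdist ((D i).bisectorCurve (D j) b t) -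
      (D i).wdist ((D i).bisectorCurve (D j) b t) with hF
  have hcont : Continuous F :=
    (continuous_wdist_bisectorCurve _ _ _ _).sub (continuous_wdist_bisectorCurve _ _ _ _)
  have hFs : 0 < F s := sub_pos.2 hv
  have hFs' : F s' < 0 := sub_neg.2 hv'
  -- Since `h` lies below the upper tangent, `F` is positive again beyond `s'`. This gives a zero on
  -- each side of `s'`, against uniqueness of the equidistant point.
  obtain ⟨T, hT, hsT⟩ := (((hd.tendsto_wdist_sub_wdist hb2 (D h)).eventually_const_lt
    (sub_pos.2 hlow)).and (eventually_ge_atTop s')).exists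
  obtain ⟨x, hx, hFx⟩ := intermediate_value_Icc' hlt.le hcont.continuousOn ⟨hFs'.le, hFs.le⟩
  obtain ⟨y, hy, hFy⟩ := intermediate_value_Icc hsT hcont.continuousOn ⟨hFs'.le, hT.le⟩
  have hset : ({h, i, j} : Set (Fin n)) = {i, j, h} := by
    ext l
    simp only [mem_insert_iff, mem_singleton_iff]
    tauto
  rw [hset] at hS hI
  have heq := equidistant_unique hgen hij hih hjh hS hI
    (v := (D i).bisectorCurve (D j) b x) (w := (D i).bisectorCurve (D j) b y)
    ⟨hd.wdist_bisectorCurve hb2 x, (sub_eq_zero.1 hFx).symm⟩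
    ⟨hd.wdist_bisectorCurve hb2 y, (sub_eq_zero.1 hFy).symm⟩
  have hxy : x < y := by
    have hxs : x ≠ s' := by
      rintro rfl
      exact hFs'.ne hFx
    exact (lt_of_le_of_ne hx.2 hxs).trans_le hy.1
  have hc := congrArg (cross ((D j).center - (D i).center)) heq
  rw [hd.cross_bisectorCurve, hd.cross_bisectorCurve, add_right_inj, mul_right_inj' hab.ne'] at hc
  exact hxy.ne (Real.sinh_injective hc)

theorem disjoint_closedBall_wdist_iff {A B : Disk} {v : Plane} (hv : 0 ≤ A.wdist v) :
    Disjoint B.carrier (Metric.closedBall v (A.wdist v)) ↔ A.wdist v < B.wdist v := by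
  rw [carrier, disjoint_closedBall_closedBall_iff B.radius_pos.le hv, wdist, wdist]
  constructor <;> intro h <;> linarith

theorem candidate_disjoint_of_prec {D : Fin n → Disk} (hconv : StronglyConvex D univ)
    (hgen : GeneralPosition D) (hccw : CounterclockwiseIndexed D) {i j h : Fin n}
    (hh : h ∈ candidates D i j) {k k' : Option (Fin n)} (hk : k ∈ canonicalIndices D i j)
    (hk' : k' ∈ canonicalIndices D i j) (hprec : PrecVertex D i j k k')
    (hdisj : Disjoint (D h).carrier (tangentDisk D i j k)) :
    Disjoint (D h).carrier (tangentDisk D i j k') := by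
  obtain ⟨hbet, hS, hI⟩ := hh
  obtain ⟨hij, hih, hjh⟩ := ne_of_mem_between hbet
  have hd : (D i).Disj (D j) := hI i (by simp) j (by simp) hij
  have hb2 := hd.minorAxis_sq
  have hw := hd.outerNormal_tangentNormal (b := -(D i).minorAxis (D j)) (by rw [neg_sq, hb2])
  have hcw : cross ((D j).center - (D i).center)
      ((D i).tangentNormal (D j) (-(D i).minorAxis (D j))) < 0 := by
    rw [hd.cross_tangentNormal]
    linarith [hd.minorAxis_pos]
  have hlow : ∀ u, OuterNormal (D i) (D j) u → 0 < cross ((D j).center - (D i).center) u →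
      (D h).supp u < (D i).supp u := fun u hu hcu =>
    supp_lt_of_between hconv hgen hccw hbet hij hih hjh hS hI hu hw hcu hcw
  match k, k' with
  | none, _ => exact hprec.elim
  | some k, none =>
    rw [disjoint_left]
    rintro q hq ⟨u, c, hu, hcu, hi, hj, hcq⟩
    have h1 := hlow u ⟨hu, hi.trans hj.symm⟩ hcu
    have h2 := inner_le_supp hu hq
    rw [show (D i).supp u = c from hi] at h1
    linarith
  | some k, some k' =>
    obtain ⟨hkb', hkS', hkI'⟩ := hk'
    obtain ⟨-, hik', hjk'⟩ := ne_of_mem_between hkb'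
    have hE : Equidistant D i j k' (vertex D i j k') :=
      Classical.epsilon_spec (exists_equidistant hij hjk' hik' hkS' hkI')
    have hb : (D i).wdist (vertex D i j k) = (D j).wdist (vertex D i j k) := hprec.1
    rw [tangentDisk, disjoint_closedBall_wdist_iff (hd.wdist_pos hb).le] at hdisj
    rw [tangentDisk, disjoint_closedBall_wdist_iff (hd.wdist_pos hE.1).le]
    have hle := not_lt.1 (not_wdist_lt_of_prec hgen hij hih hjh hS hI
      (hlow _ (hd.outerNormal_tangentNormal hb2) (by
        rw [hd.cross_tangentNormal]
        linarith [hd.minorAxis_pos])) hprec hdisj)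
    -- Equality would make the vertex of `k'` equidistant from four disks; `h` and `k'` differ
    -- because they lie in opposite cyclic intervals.
    refine lt_of_le_of_ne hle fun heq => ?_
    exact hgen.no_equidistant i j k' h hij hjk' hih hik' hjh
      (ne_of_mem_between_of_mem_between hbet hkb').symm ⟨_, hE.1, hE.2, heq⟩

end

theorem mainTheorem7 {n : ℕ} (D : Fin n → Disk)
    (hconv : StronglyConvex D Set.univ) (hgen : GeneralPosition D)
    (hccw : CounterclockwiseIndexed D) (i j : Fin n) :
    (∀ k : Fin n, some k ∈ canonicalIndices D i j → ∃! v : Plane, Equidistant D i j k v) ∧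
    ∀ k ∈ canonicalIndices D i j, ∀ k' ∈ canonicalIndices D i j, PrecVertex D i j k k' →
      (∀ h ∈ candidates D i j, Disjoint (D h).carrier (tangentDisk D i j k) →
        Disjoint (D h).carrier (tangentDisk D i j k')) ∧
      admissibleConvex D i j k ⊆ admissibleConvex D i j k' := by
  refine ⟨?_, ?_⟩
  · rintro k ⟨hkb, hkS, hkI⟩
    obtain ⟨hji, hjk, hik⟩ := ne_of_mem_between hkb
    obtain ⟨v, hv⟩ := exists_equidistant hji.symm hik hjk hkS hkI
    exact ⟨v, hv, fun w hw => equidistant_unique hgen hji.symm hik hjk hkS hkI hw hv⟩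
  · intro k hk k' hk' hprec
    have hmain : ∀ h ∈ candidates D i j, Disjoint (D h).carrier (tangentDisk D i j k) →
        Disjoint (D h).carrier (tangentDisk D i j k') := fun h hh hdisj =>
      candidate_disjoint_of_prec hconv hgen hccw hh hk hk' hprec hdisj
    refine ⟨hmain, ?_⟩
    match k, hk with
    | none, _ => exact hprec.elim
    | some k, hk =>
      rintro h ⟨⟨hbet, hhi, hhj, hdisj⟩, hS⟩
      obtain ⟨hij, -, -⟩ := ne_of_mem_between hbet
      -- Admissibility does not include disjointness of `i` and `j`; it comes from the canonical
      -- triple and turns `h` into a candidate.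
      have hd : (D i).Disj (D j) := hk.2.2 i (by simp) j (by simp) hij
      have hI : Independent D {h, i, j} := by
        rintro a (rfl | rfl | rfl) b (rfl | rfl | rfl) hab
        exacts [absurd rfl hab, hhi, hhj, hhi.symm, absurd rfl hab, hd, hhj.symm, hd.symm,
          absurd rfl hab]
      have hdisj' := hmain h ⟨hbet, hS, hI⟩ hdisj
      refine ⟨?_, hS⟩
      match k' with
      | none => exact ⟨hbet, hhi, hhj⟩
      | some k' => exact ⟨hbet, hhi, hhj, hdisj'⟩
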